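/- Let $G$ be a finite simple graph. A list assignment $L$ of $G$ assigns to each vertex $v$ a set $L(v)$ of colors. A matching assignment over $L$ assigns to each edge $uv$ of $G$ a (possibly empty) matching $M_{L,uv}$ between $\{u\}\times L(u)$ and $\{v\}\times L(v)$. The corresponding cover of $G$ is the graph with vertex set $\{(u,c): u\in V(G),\ c\in L(u)\}$ in which each set $\{u\}\times L(u)$ is a clique and whose remaining edges are exactly the edges of the matchings $M_{L,uv}$, $uv\in E(G)$. The DP-chromatic number $\chi_{DP}(G)$ is the minimum integer $k$ such that, for every list assignment $L$ with $|L(v)|\ge k$ for all $v\in V(G)$ and every matching assignment over $L$, the corresponding cover has an independent set of size $|V(G)|$. Theorem. If $G$ is a finite simple planar graph in which no cycle of length $4$ shares an edge with a cycle of length $3$, then $\chi_{DP}(G)\le 4$, that is, $G$ is DP-$4$-colorable. -/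

import Mathlib

universe u w

/-- `A` is a polygonal arc in the plane with ends `a` and `b`: it is the union of the segments
`[p 0, p 1], …, [p (n - 1), p n]` with `p 0 = a`, `p n = b` and distinct corners, where
consecutive segments meet only in their common corner and other segments do not meet. -/
def IsPolygonalArc (a b : EuclideanSpace ℝ (Fin 2)) (A : Set (EuclideanSpace ℝ (Fin 2))) : Prop :=
  ∃ (n : ℕ) (p : ℕ → EuclideanSpace ℝ (Fin 2)),
    p 0 = a ∧ p n = b ∧ Set.InjOn p (Set.Iic n) ∧
    A = ⋃ i ∈ Set.Iio n, segment ℝ (p i) (p (i + 1)) ∧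
    ∀ i j : ℕ, i < j → j < n →
      ∀ x ∈ segment ℝ (p i) (p (i + 1)) ∩ segment ℝ (p j) (p (j + 1)), j = i + 1 ∧ x = p j

namespace SimpleGraph

/-- A drawing of `G` in the plane without crossings: vertices are distinct points, every edge `uv`
is an arc joining `u` and `v`, an edge contains no vertex other than its ends, and two different
edges meet only in common ends. As is usual in graph theory, arcs are polygonal. -/
structure PlaneDrawing {V : Type u} (G : SimpleGraph V) where
  /-- the point that represents a vertex -/
  pos : V → EuclideanSpace ℝ (Fin 2)
  pos_injective : Function.Injective pos
  /-- the arc that represents an edge (values at non-edges are irrelevant) -/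
  arc : Sym2 V → Set (EuclideanSpace ℝ (Fin 2))
  isPolygonalArc_arc : ∀ u v : V, G.Adj u v → IsPolygonalArc (pos u) (pos v) (arc s(u, v))
  mem_of_pos_mem_arc : ∀ e ∈ G.edgeSet, ∀ v : V, pos v ∈ arc e → v ∈ e
  exists_of_mem_arc_inter : ∀ e ∈ G.edgeSet, ∀ f ∈ G.edgeSet, e ≠ f →
    ∀ x ∈ arc e ∩ arc f, ∃ v : V, v ∈ e ∧ v ∈ f ∧ x = pos v

/-- A graph is planar if it can be drawn in the plane without crossings. -/
def IsPlanar {V : Type u} (G : SimpleGraph V) : Prop := Nonempty G.PlaneDrawing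

/-- A matching assignment over the list assignment `L`: for every edge `uv` of `G` a (possibly
empty) matching between `{u} × L u` and `{v} × L v`; `rel u v a b` says that `(u, a)(v, b)` is an
edge of the matching for `uv`. -/
structure MatchingAssignment {V : Type u} (G : SimpleGraph V) {C : Type w} (L : V → Set C) where
  rel : ∀ u v : V, L u → L v → Prop
  adj : ∀ (u v : V) (a : L u) (b : L v), rel u v a b → G.Adj u v
  symm : ∀ (u v : V) (a : L u) (b : L v), rel u v a b → rel v u b a
  unique : ∀ (u v : V) (a : L u) (b b' : L v), rel u v a b → rel u v a b' → b = b'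

/-- The cover of `G` given by a matching assignment: its vertices are the pairs `(u, c)` with
`c ∈ L u`, each `{u} × L u` is a clique, and the other edges are those of the matchings. -/
def MatchingAssignment.cover {V : Type u} {G : SimpleGraph V} {C : Type w} {L : V → Set C}
    (M : G.MatchingAssignment L) : SimpleGraph (Σ u : V, L u) where
  Adj x y := x ≠ y ∧ (x.1 = y.1 ∨ M.rel x.1 y.1 x.2 y.2)
  symm := ⟨fun _ _ h => ⟨h.1.symm, h.2.imp Eq.symm (M.symm _ _ _ _)⟩⟩
  loopless := ⟨fun _ h => h.1 rfl⟩

/-- `G` admits a colouring for the matching assignment `M`: the cover has an independent set of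
size `|V(G)|`. -/
def MatchingAssignment.Colorable {V : Type u} [Fintype V] {G : SimpleGraph V} {C : Type w}
    {L : V → Set C} (M : G.MatchingAssignment L) : Prop :=
  ∃ I : Finset (Σ u : V, L u), M.cover.IsIndepSet (I : Set (Σ u : V, L u)) ∧
    I.card = Fintype.card V

/-- The DP-chromatic number of `G`: the least `k` such that `G` admits a colouring for every
assignment of lists with at least `k` colours each and every matching assignment over it
(`⊤` if there were no such `k`). -/
noncomputable def dpChromaticNumber {V : Type u} [Fintype V] (G : SimpleGraph V) : ℕ∞ :=
  ⨅ k ∈ {k : ℕ | ∀ (C : Type w) (L : V → Set C), (∀ v, (k : ℕ∞) ≤ (L v).encard) →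
    ∀ M : G.MatchingAssignment L, M.Colorable}, (k : ℕ∞)

end SimpleGraph

/-! If some assignment with lists of size at least four has no colouring, restrict to an
inclusion-minimal set of vertices that cannot be coloured (`exists_critical`). The induced graph is
still planar, it has minimum degree at least four, and by `Critical.false_of_cycle` it contains no
cycle x, …, y whose vertices other than x have degree four while x has fewer neighbours off the
cycle than y. This one reducible configuration is used twice: a triangle on an edge of a pentagon of
4-vertices has an apex of degree at least five (`degree_apex_ne_four`), and at a 5-vertex certain
pairs of pentagons with no other big vertex are excluded (`false_of_two_fiveCycles`).

The rest is discharging. Give a vertex its degree minus 4 and a face its length minus 4, spread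
evenly over darts as `1 - 4 / degree` and `1 - 4 / len`. The total is 4(E - V - F), which Euler's
formula makes negative. A facial triangle receives 1/3 across each edge. Triangles share no edge
with triangles or 4-faces, and faces of length at least six can afford the payment, so only
pentagons may be short. A vertex of degree at least five pays a pentagon at it, once for each
incident edge that lies in a facial triangle: 1/3 if it is the only big vertex of the pentagon, and
1/6 otherwise. A pentagon of 4-vertices instead gets 1/6 from the apex opposite the middle one of
three consecutive triangular edges. `Pent.charge_nonneg` shows that pentagons then have enough, and
`sum_out_le` that vertices can afford it; together they yield `card_add_card_le`.

Only the inequality F ≥ E - V + 1 is needed, so neither connectedness nor the Jordan curve theorem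
enters. A polygonal drawing is swept by a vertical line. The regions are classes of segments (each
standing for what lies just above it) and a bottom element, with one identification at each corner;
counting gives enough of them (`SegmentSystem.card_add_one_le`). Each facial walk of the induced
rotation system keeps one region on its left (`left_eq_of_isCyclicNext`), and every region occurs
(`left_first_surjective`), so there are at least as many faces as regions. -/

/-! ### Critical assignments and the reducible cycle. -/

namespace SimpleGraph.MatchingAssignment

variable {V : Type u} {G : SimpleGraph V} {C : Type w} {L : V → Set C}

/-- A choice of colours without conflicts inside `T`. -/
def ProperOn (M : G.MatchingAssignment L) (T : Set V) (f : ∀ v, L v) : Prop :=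
  ∀ u ∈ T, ∀ v ∈ T, ¬ M.rel u v (f u) (f v)

/-- `M` has no proper colouring, but every proper set of vertices can be coloured. -/
structure Critical (M : G.MatchingAssignment L) : Prop where
  four_le : ∀ v, 4 ≤ (L v).encard
  not_properOn_univ : ∀ f, ¬ M.ProperOn Set.univ f
  exists_properOn : ∀ T : Set V, T ≠ Set.univ → ∃ f, M.ProperOn T f

/-- The matching assignment induced on a set of vertices. -/
def induce (M : G.MatchingAssignment L) (S : Set V) :
    (G.induce S).MatchingAssignment (fun v : S => L v) where
  rel u v a b := M.rel u v a b
  adj u v a b h := M.adj u v a b h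
  symm u v a b h := M.symm u v a b h
  unique u v a b b' h h' := M.unique u v a b b' h h'

theorem ProperOn.mono {M : G.MatchingAssignment L} {T T' : Set V} {f : ∀ v, L v}
    (h : M.ProperOn T f) (hT : T' ⊆ T) : M.ProperOn T' f :=
  fun u hu v hv => h u (hT hu) v (hT hv)

theorem colorable_of_properOn_univ [Fintype V] (M : G.MatchingAssignment L) (f : ∀ v, L v)
    (h : M.ProperOn Set.univ f) : M.Colorable := by
  classical
  refine ⟨Finset.univ.map ⟨fun v => (⟨v, f v⟩ : Σ u : V, L u), fun a b hab => congrArg Sigma.fst hab⟩,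
    ?_, by simp⟩
  intro x hx y hy hne hadj
  simp only [Finset.coe_map, Finset.coe_univ, Set.image_univ,
    Set.mem_range] at hx hy
  obtain ⟨u, rfl⟩ := hx
  obtain ⟨v, rfl⟩ := hy
  rcases hadj.2 with h' | h'
  · exact hne (by cases h'; rfl)
  · exact h u trivial v trivial h'

theorem exists_critical [Finite V] (M : G.MatchingAssignment L) (hL : ∀ v, 4 ≤ (L v).encard)
    (hM : ∀ f, ¬ M.ProperOn Set.univ f) : ∃ S : Set V, (M.induce S).Critical := by
  classical
  have hne : ∀ v, Nonempty (L v) := fun v => by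
    by_contra h
    have : (L v) = ∅ := by
      rwa [Set.nonempty_coe_sort, Set.not_nonempty_iff_eq_empty] at h
    simpa [this] using hL v
  -- `S` is an inclusion-minimal uncolourable set; colours outside `S` are filled in arbitrarily, as
  -- the lists are nonempty.
  obtain ⟨S, hS, hmin⟩ := (Set.toFinite {S : Set V | ∀ f, ¬ M.ProperOn S f}).exists_minimal
    ⟨Set.univ, hM⟩
  refine ⟨S, fun v => hL v, ?_, ?_⟩
  · intro f hf
    refine hS (fun v => if h : v ∈ S then f ⟨v, h⟩ else (hne v).some) ?_
    intro u hu v hv h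
    simp only [hu, hv, dif_pos] at h
    exact hf ⟨u, hu⟩ trivial ⟨v, hv⟩ trivial h
  · intro T hT
    by_contra hcon
    push Not at hcon
    have hTS : Subtype.val '' T ⊆ S := by rintro _ ⟨x, -, rfl⟩; exact x.2
    have h1 : ∀ f, ¬ M.ProperOn (Subtype.val '' T) f := by
      intro f hf
      exact hcon (fun v => f v) fun u hu v hv h => hf u ⟨u, hu, rfl⟩ v ⟨v, hv, rfl⟩ h
    have h2 := hmin h1 hTS
    apply hT
    ext x
    simp only [Set.mem_univ, iff_true]
    obtain ⟨y, hy, hyx⟩ := h2 x.2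
    rwa [← Subtype.ext hyx]

/-- The edges of `G` carry matchings, so each vertex of `N` rules out at most one colour of `v`. -/
theorem encard_le_of_blocked (M : G.MatchingAssignment L) {v : V} (f : ∀ v, L v) (A : Set (L v))
    (N : Finset V) (h : ∀ c ∈ A, ∃ u ∈ N, M.rel v u c (f u)) : A.encard ≤ N.card := by
  have : Nonempty V := ⟨v⟩
  choose! g hg hg' using h
  rw [← Set.encard_coe_eq_coe_finsetCard]
  refine Set.encard_le_encard_of_injOn (f := g) (fun c hc => hg c hc) ?_
  intro c hc c' hc' hcc
  have h1 := M.symm _ _ _ _ (hg' c hc)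
  have h2 := M.symm _ _ _ _ (hg' c' hc')
  rw [← hcc] at h2
  exact M.unique _ _ _ _ _ h1 h2

theorem ProperOn.update [DecidableEq V] {M : G.MatchingAssignment L} {T : Set V} {f : ∀ v, L v}
    (h : M.ProperOn T f) {v : V} (hv : v ∉ T) (c : L v) (hc : ∀ u ∈ T, ¬ M.rel v u c (f u)) :
    M.ProperOn (insert v T) (Function.update f v c) := by
  have hne : ∀ u ∈ T, u ≠ v := fun u hu huv => hv (huv ▸ hu)
  rintro a (rfl | ha) b (rfl | hb) hr
  · exact (M.adj _ _ _ _ hr).ne rfl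
  · rw [Function.update_self, Function.update_of_ne (hne b hb)] at hr
    exact hc b hb hr
  · rw [Function.update_self, Function.update_of_ne (hne a ha)] at hr
    exact hc a ha (M.symm _ _ _ _ hr)
  · rw [Function.update_of_ne (hne a ha), Function.update_of_ne (hne b hb)] at hr
    exact h a ha b hb hr

theorem encard_univ_coe (A : Set C) : (Set.univ : Set A).encard = A.encard := by
  rw [Set.encard_univ, Set.encard]

theorem ProperOn.exists_extend {M : G.MatchingAssignment L} {T : Set V} {f : ∀ v, L v} {v : V}
    (hL : 4 ≤ (L v).encard) {N : Finset V} (hN : ∀ u ∈ T, G.Adj v u → u ∈ N) (hcard : N.card ≤ 3) :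
    ∃ c : L v, ∀ u ∈ T, ¬ M.rel v u c (f u) := by
  by_contra hcon
  push Not at hcon
  have h := M.encard_le_of_blocked f Set.univ N fun c _ => by
    obtain ⟨u, hu, hr⟩ := hcon c
    exact ⟨u, hN u hu (M.adj _ _ _ _ hr), hr⟩
  rw [encard_univ_coe] at h
  have := hL.trans h
  norm_cast at this
  omega

theorem four_le_encard_add {M : G.MatchingAssignment L} (f : ∀ v, L v) {v : V}
    (hL : 4 ≤ (L v).encard) (T : Set V) (N : Finset V) (hN : ∀ u ∈ T, G.Adj v u → u ∈ N) :
    4 ≤ {c : L v | ∀ u ∈ T, ¬ M.rel v u c (f u)}.encard + N.card := by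
  have h1 := M.encard_le_of_blocked f {c : L v | ∀ u ∈ T, ¬ M.rel v u c (f u)}ᶜ N fun c hc => by
    simp only [Set.mem_compl_iff, Set.mem_ofPred_eq, not_forall, not_not] at hc
    obtain ⟨u, hu, hr⟩ := hc
    exact ⟨u, hN u hu (M.adj _ _ _ _ hr), hr⟩
  calc (4 : ℕ∞) ≤ (L v).encard := hL
    _ = (Set.univ : Set (L v)).encard := (encard_univ_coe _).symm
    _ = _ := (Set.encard_add_encard_compl _).symm
    _ ≤ _ := by gcongr

variable [Fintype V] [DecidableEq V] [DecidableRel G.Adj]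

theorem Critical.four_le_degree {M : G.MatchingAssignment L} (hM : M.Critical) (v : V) :
    4 ≤ G.degree v := by
  by_contra hlt
  obtain ⟨f, hf⟩ := hM.exists_properOn {v}ᶜ (by
    intro h
    have : v ∈ ({v}ᶜ : Set V) := h ▸ Set.mem_univ v
    exact this rfl)
  obtain ⟨c, hc⟩ := ProperOn.exists_extend (M := M) (T := {v}ᶜ) (f := f) (hM.four_le v)
    (N := G.neighborFinset v) (fun u _ h => by simpa using h)
    (by rw [card_neighborFinset_eq_degree]; omega)
  refine hM.not_properOn_univ _ ((hf.update (by simp) c hc).mono ?_)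
  intro u _
  by_cases h : u = v <;> simp [h]

/-- When a vertex of the path gets its turn, its successor is still uncoloured, so at most three of
its neighbours have colours. The vertex `y` serves only as the successor of the last one and remains
uncoloured. -/
theorem ProperOn.exists_greedy {M : G.MatchingAssignment L} (hL : ∀ v, 4 ≤ (L v).encard)
    (l : List V) (y : V) : ∀ (T : Set V) (f : ∀ v, L v), M.ProperOn T f → (l ++ [y]).Nodup →
    (∀ z ∈ l ++ [y], z ∉ T) → List.IsChain G.Adj (l ++ [y]) → (∀ z ∈ l, G.degree z ≤ 4) →
    ∃ f' : ∀ v, L v, M.ProperOn (T ∪ {z | z ∈ l}) f' ∧ ∀ u ∈ T, f' u = f u := by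
  induction l with
  | nil => intro T f hf _ _ _ _; exact ⟨f, by simpa using hf, fun _ _ => rfl⟩
  | cons z l ih =>
    intro T f hf hnd hT hch hdeg
    obtain ⟨b, hzb, hbT, hbm⟩ : ∃ b, G.Adj z b ∧ b ∉ T ∧ b ∈ l ++ [y] := by
      cases l with
      | nil =>
        simp only [List.cons_append, List.nil_append] at hch hT
        exact ⟨y, by simpa using hch, hT y (by simp), by simp⟩
      | cons b l =>
        simp only [List.cons_append, List.isChain_cons_cons] at hch
        exact ⟨b, hch.1, hT b (by simp), by simp⟩
    have hzT : z ∉ T := hT z (by simp)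
    obtain ⟨c, hc⟩ := ProperOn.exists_extend (M := M) (T := T) (f := f) (hL z)
      (N := (G.neighborFinset z).erase b)
      (fun u hu h => by
        simp only [Finset.mem_erase, mem_neighborFinset]
        exact ⟨fun hub => hbT (hub ▸ hu), h⟩)
      (by
        rw [Finset.card_erase_of_mem (by simpa using hzb), card_neighborFinset_eq_degree]
        have := hdeg z (by simp)
        omega)
    simp only [List.cons_append, List.nodup_cons] at hnd
    obtain ⟨f', hf', hagree⟩ := ih (insert z T) _ (hf.update hzT c hc) hnd.2
      (by
        intro x hx
        rintro (rfl | hxT)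
        · exact hnd.1 hx
        · exact hT x (by simp only [List.cons_append, List.mem_cons]; exact Or.inr hx) hxT)
      (by simp only [List.cons_append] at hch; exact hch.tail)
      (fun x hx => hdeg x (by simp [hx]))
    refine ⟨f', hf'.mono ?_, ?_⟩
    · rintro x (hx | hx)
      · exact Or.inl (Or.inr hx)
      · simp only [Set.mem_ofPred_eq, List.mem_cons] at hx
        rcases hx with rfl | hx
        · exact Or.inl (Or.inl rfl)
        · exact Or.inr hx
    · intro u hu
      rw [hagree u (Or.inr hu), Function.update_of_ne (by rintro rfl; exact hzT hu)]

/-- In a critical assignment there is no cycle whose vertices, but possibly the first, have degree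
at most four, and whose first vertex has fewer neighbours outside the cycle than its last. -/
theorem Critical.false_of_cycle {M : G.MatchingAssignment L} (hM : M.Critical) (x y : V)
    (l : List V) (hnd : (x :: (l ++ [y])).Nodup) (hch : List.IsChain G.Adj (x :: (l ++ [y])))
    (hyx : G.Adj y x) (hl : ∀ z ∈ l, G.degree z ≤ 4) (hy : G.degree y ≤ 4)
    (hout : ((G.neighborFinset x).filter (· ∉ x :: (l ++ [y]))).card <
      ((G.neighborFinset y).filter (· ∉ x :: (l ++ [y]))).card) : False := by
  set S := x :: (l ++ [y]) with hS
  set T : Set V := {z | z ∉ S} with hT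
  have hxS : x ∈ S := by simp [hS]
  have hyS : y ∈ S := by simp [hS]
  have hxy : y ≠ x := hyx.ne
  obtain ⟨f, hf⟩ := hM.exists_properOn T (by
    intro h
    have : x ∈ T := h ▸ Set.mem_univ x
    exact this hxS)
  set ox := (G.neighborFinset x).filter (· ∉ S)
  set oy := (G.neighborFinset y).filter (· ∉ S)
  have hAx := four_le_encard_add (M := M) f (hM.four_le x) T ox
    (fun u hu h => Finset.mem_filter.2 ⟨by simpa using h, hu⟩)
  have hAy := four_le_encard_add (M := M) f (hM.four_le y) T oy
    (fun u hu h => Finset.mem_filter.2 ⟨by simpa using h, hu⟩)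
  set Ax := {c : L x | ∀ u ∈ T, ¬ M.rel x u c (f u)}
  set Ay := {c : L y | ∀ u ∈ T, ¬ M.rel y u c (f u)}
  -- neighbours of `y` inside the list
  set iy := ((G.neighborFinset y).filter (· ∈ S)).erase x with hiy
  have hcard : iy.card + 1 + oy.card ≤ 4 := by
    have h1 : iy.card + 1 = ((G.neighborFinset y).filter (· ∈ S)).card :=
      Finset.card_erase_add_one (by simpa [hxS] using hyx)
    have h2 := Finset.card_filter_add_card_filter_not (s := G.neighborFinset y) (· ∈ S)
    rw [card_neighborFinset_eq_degree] at h2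
    change _ + oy.card = _ at h2
    omega
  -- `Ay` is cut down to exactly `4 - oy.card` colours, to be strictly smaller than `Ax`. The
  -- subtraction is not truncated, by `hcard`.
  obtain ⟨A', hA'sub, hA'card⟩ : ∃ A' ⊆ Ay, A'.encard = ((4 - oy.card : ℕ) : ℕ∞) := by
    apply Set.exists_subset_encard_eq
    have : ((4 - oy.card : ℕ) : ℕ∞) + oy.card ≤ Ay.encard + oy.card := by
      refine le_trans ?_ hAy
      norm_cast
      omega
    exact (ENat.add_le_add_iff_right (ENat.natCast_ne_top _)).1 this
  -- Pigeonhole: the matching cannot send all of `Ax` into the smaller set `A'`, so `x` has a colour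
  -- that costs `y` nothing from `A'`.
  obtain ⟨c, hcA, hc⟩ : ∃ c ∈ Ax, ∀ b ∈ A', ¬ M.rel x y c b := by
    by_contra hcon
    push Not at hcon
    have : Nonempty (L y) := ⟨f y⟩
    choose! g hg hg' using hcon
    have h1 : Ax.encard ≤ A'.encard := Set.encard_le_encard_of_injOn (f := g) hg (by
      intro a ha b hb hab
      have h1 := M.symm _ _ _ _ (hg' a ha)
      have h2 := M.symm _ _ _ _ (hg' b hb)
      rw [← hab] at h2
      exact M.unique _ _ _ _ _ h1 h2)
    rw [hA'card] at h1
    have h2 : (4 : ℕ∞) ≤ ((4 - oy.card : ℕ) : ℕ∞) + ox.card := hAx.trans (by gcongr)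
    norm_cast at h2
    omega
  have hxT : x ∉ T := fun h => h hxS
  have hnd' := (List.nodup_cons.1 hnd)
  obtain ⟨f', hf', hagree⟩ := ProperOn.exists_greedy hM.four_le l y (insert x T) _
    (hf.update hxT c hcA) hnd'.2
    (by
      intro z hz
      rintro (rfl | hzT)
      · exact hnd'.1 hz
      · exact hzT (by simp only [hS, List.mem_cons]; exact Or.inr hz))
    hch.tail hl
  have hf'x : f' x = c := by rw [hagree x (Or.inl rfl), Function.update_self]
  have hf'T : ∀ u ∈ T, f' u = f u := fun u hu => by
    rw [hagree u (Or.inr hu), Function.update_of_ne (by rintro rfl; exact hxT hu)]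
  have hyl : y ∉ l := by
    have := hnd'.2
    rw [List.nodup_append] at this
    exact fun h => this.2.2 y h y (by simp) rfl
  -- With `x` harmless, the neighbours of `y` in `iy` block at most `3 - oy.card` colours of `A'`.
  obtain ⟨b, hbA, hb⟩ : ∃ b ∈ A', ∀ u ∈ l, ¬ M.rel y u b (f' u) := by
    by_contra hcon
    push Not at hcon
    have h1 := M.encard_le_of_blocked f' A' iy fun b hb => by
      obtain ⟨u, hu, hr⟩ := hcon b hb
      refine ⟨u, ?_, hr⟩
      simp only [hiy, Finset.mem_erase, Finset.mem_filter, mem_neighborFinset]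
      exact ⟨fun h => hnd'.1 (by simp [← h, hu]), M.adj _ _ _ _ hr, by simp [hS, hu]⟩
    rw [hA'card] at h1
    norm_cast at h1
    omega
  have hynot : y ∉ insert x T ∪ {z | z ∈ l} := by
    rintro ((h | h) | h)
    · exact hxy h
    · exact h hyS
    · exact hyl h
  refine hM.not_properOn_univ _ ((hf'.update hynot b ?_).mono ?_)
  · rintro u ((rfl | hu) | hu) hr
    · rw [hf'x] at hr
      exact hc b hbA (M.symm _ _ _ _ hr)
    · rw [hf'T u hu] at hr
      exact hA'sub hbA u hu hr
    · exact hb u hu hr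
  · intro u _
    by_cases hu : u ∈ S
    · simp only [hS, List.mem_cons, List.mem_append, List.not_mem_nil, or_false] at hu
      rcases hu with h | h | h
      · exact Or.inr (Or.inl (Or.inl h))
      · exact Or.inr (Or.inr h)
      · exact Or.inl h
    · exact Or.inr (Or.inl (Or.inr hu))

end SimpleGraph.MatchingAssignment

/-! ### Reducible configurations at pentagons. -/

namespace SimpleGraph

variable {V : Type u} {G : SimpleGraph V}

/-- A cycle of length five. -/
structure FiveCycle (G : SimpleGraph V) (a b c d e : V) : Prop where
  ab : G.Adj a b
  bc : G.Adj b c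
  cd : G.Adj c d
  de : G.Adj d e
  ea : G.Adj e a
  ac : a ≠ c
  bd : b ≠ d
  ce : c ≠ e
  da : d ≠ a
  eb : e ≠ b

theorem FiveCycle.rotate {a b c d e : V} (h : G.FiveCycle a b c d e) : G.FiveCycle b c d e a :=
  ⟨h.bc, h.cd, h.de, h.ea, h.ab, h.bd, h.ce, h.da, h.eb, h.ac⟩

theorem FiveCycle.reverse {a b c d e : V} (h : G.FiveCycle a b c d e) : G.FiveCycle a e d c b :=
  ⟨h.ea.symm, h.de.symm, h.cd.symm, h.bc.symm, h.ab.symm, h.da.symm, h.ce.symm, h.bd.symm,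
    h.ac.symm, h.eb.symm⟩

variable [Fintype V] [DecidableEq V]

/-- The local properties of a critical graph without triangles adjacent to 4-cycles. -/
structure IsCriticalLike (G : SimpleGraph V) [DecidableRel G.Adj] : Prop where
  four_le_degree : ∀ v, 4 ≤ G.degree v
  triangle_unique : ∀ a b c d, G.Adj a b → G.Adj a c → G.Adj b c → G.Adj a d → G.Adj b d → c = d
  triangle_four_cycle : ∀ a b c x y, G.Adj a b → G.Adj a c → G.Adj b c → G.Adj b x → G.Adj x y →
    G.Adj y a → x ≠ a → y ≠ b → False
  cycle : ∀ (x y : V) (l : List V), (x :: (l ++ [y])).Nodup →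
    List.IsChain G.Adj (x :: (l ++ [y])) → G.Adj y x → (∀ z ∈ l, G.degree z ≤ 4) →
    G.degree y ≤ 4 → ((G.neighborFinset x).filter (· ∉ x :: (l ++ [y]))).card <
      ((G.neighborFinset y).filter (· ∉ x :: (l ++ [y]))).card → False

variable [DecidableRel G.Adj]

namespace IsCriticalLike

/-- A chord cuts a pentagon into a triangle and a 4-cycle that share it. -/
theorem not_adj_of_fiveCycle (hG : G.IsCriticalLike) {a b c d e : V}
    (h : G.FiveCycle a b c d e) : ¬ G.Adj a c := fun hac =>
  hG.triangle_four_cycle a c b d e hac h.ab h.bc.symm h.cd h.de h.ea h.da h.ce.symm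

/-- Counting form of `cycle`: `A` bounds from below the neighbours of `x` on the cycle and `B`
bounds from above those of `y`, which compares the numbers of neighbours outside. -/
theorem false_of_cycle_of_card (hG : G.IsCriticalLike) (x y : V) (l : List V) (A B : Finset V)
    (hnd : (x :: (l ++ [y])).Nodup) (hch : List.IsChain G.Adj (x :: (l ++ [y])))
    (hyx : G.Adj y x) (hl : ∀ z ∈ l, G.degree z = 4) (hy : G.degree y = 4)
    (hA : ∀ z ∈ A, G.Adj x z ∧ z ∈ x :: (l ++ [y]))
    (hB : ∀ z ∈ x :: (l ++ [y]), G.Adj y z → z ∈ B)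
    (hcard : G.degree x + B.card < 4 + A.card) : False := by
  refine hG.cycle x y l hnd hch hyx (fun z hz => (hl z hz).le) hy.le ?_
  have h1 := Finset.card_filter_add_card_filter_not (s := G.neighborFinset x)
    (· ∈ x :: (l ++ [y]))
  have h2 := Finset.card_filter_add_card_filter_not (s := G.neighborFinset y)
    (· ∈ x :: (l ++ [y]))
  have h3 : A.card ≤ ((G.neighborFinset x).filter (· ∈ x :: (l ++ [y]))).card :=
    Finset.card_le_card fun z hz => Finset.mem_filter.2 ⟨by simpa using (hA z hz).1, (hA z hz).2⟩
  have h4 : ((G.neighborFinset y).filter (· ∈ x :: (l ++ [y]))).card ≤ B.card :=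
    Finset.card_le_card fun z hz => by
      rw [Finset.mem_filter] at hz
      exact hB z hz.2 (by simpa using hz.1)
  rw [card_neighborFinset_eq_degree] at h1 h2
  omega

/-- A triangle on an edge of a 5-cycle of vertices of degree four has its third vertex of larger
degree. -/
theorem degree_apex_ne_four (hG : G.IsCriticalLike) {a b c d e w : V}
    (h : G.FiveCycle a b c d e) (hwa : G.Adj w a) (hwb : G.Adj w b)
    (ha : G.degree a = 4) (hb : G.degree b = 4) (hc : G.degree c = 4) (hd : G.degree d = 4)
    (he : G.degree e = 4) : G.degree w ≠ 4 := by
  intro hw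
  have nac := hG.not_adj_of_fiveCycle h
  have nbd := hG.not_adj_of_fiveCycle h.rotate
  have nce := hG.not_adj_of_fiveCycle h.rotate.rotate
  have nda := hG.not_adj_of_fiveCycle h.rotate.rotate.rotate
  have neb := hG.not_adj_of_fiveCycle h.rotate.rotate.rotate.rotate
  have hwc : w ≠ c := by rintro rfl; exact nac hwa.symm
  have hwd : w ≠ d := by rintro rfl; exact nda hwa
  have hwe : w ≠ e := by rintro rfl; exact neb hwb
  have hew : ¬ G.Adj e w := fun hew =>
    h.eb (hG.triangle_unique a w b e hwa.symm h.ab hwb h.ea.symm hew.symm).symm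
  -- On the cycle a, w, b, c, d, e the vertex `a` has its neighbours w, b, e, so one outside, while
  -- `e` has only a and d, so two outside.
  refine hG.false_of_cycle_of_card a e [w, b, c, d] {w, b, e} {a, d} ?_ ?_ h.ea ?_ he ?_ ?_ ?_
  · simp [hwa.ne', h.ab.ne, h.ac, h.da.symm, h.ea.ne', hwb.ne, hwc, hwd, hwe, h.bc.ne, h.bd,
      h.eb.symm, h.cd.ne, h.ce, h.de.ne]
  · simp [hwa.symm, hwb, h.bc, h.cd, h.de]
  · simp [hw, hb, hc, hd]
  · simp [hwa.symm, h.ab, h.ea.symm]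
  · intro z hz hez
    simp only [List.cons_append, List.nil_append, List.mem_cons, List.not_mem_nil, or_false] at hz
    rcases hz with rfl | rfl | rfl | rfl | rfl | rfl
    · simp
    · exact (hew hez).elim
    · exact (neb hez).elim
    · exact (nce hez.symm).elim
    · simp
    · exact (hez.ne rfl).elim
  · rw [Finset.card_eq_three.2 ⟨w, b, e, hwb.ne, hwe, h.eb.symm, rfl⟩, ha]
    have := Finset.card_le_two (a := a) (b := d)
    omega

/-- Two 5-cycles through a vertex of degree five, all of whose other vertices have degree four,
cannot be separated by one triangle if the next edge of one of them is in a triangle, too. -/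
theorem false_of_two_fiveCycles (hG : G.IsCriticalLike) {v b c d e p q r s w : V}
    (h : G.FiveCycle v b c d e) (k : G.FiveCycle v p q r s) (hsb : G.Adj s b)
    (hwv : G.Adj v w) (hwe : G.Adj e w) (hpw : p ≠ w) (hpe : p ≠ e) (hv : G.degree v = 5)
    (hb : G.degree b = 4) (hc : G.degree c = 4) (hd : G.degree d = 4) (he : G.degree e = 4)
    (hp : G.degree p = 4) (hq : G.degree q = 4) (hr : G.degree r = 4) (hs : G.degree s = 4) :
    False := by
  have nvc := hG.not_adj_of_fiveCycle h
  have nbd := hG.not_adj_of_fiveCycle h.rotate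
  have nce := hG.not_adj_of_fiveCycle h.rotate.rotate
  have ndv := hG.not_adj_of_fiveCycle h.rotate.rotate.rotate
  have neb := hG.not_adj_of_fiveCycle h.rotate.rotate.rotate.rotate
  have nvq := hG.not_adj_of_fiveCycle k
  have npr := hG.not_adj_of_fiveCycle k.rotate
  have nqs := hG.not_adj_of_fiveCycle k.rotate.rotate
  have nrv := hG.not_adj_of_fiveCycle k.rotate.rotate.rotate
  have nsp := hG.not_adj_of_fiveCycle k.rotate.rotate.rotate.rotate
  have hse : s ≠ e := by rintro rfl; exact neb hsb
  have hpb : p ≠ b := by rintro rfl; exact nsp hsb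
  have hpc : p ≠ c := by rintro rfl; exact nvc k.ab
  have hpd : p ≠ d := by rintro rfl; exact ndv k.ab.symm
  have hsc : s ≠ c := by rintro rfl; exact nvc k.ea.symm
  have hsd : s ≠ d := by rintro rfl; exact ndv k.ea
  have hqb : q ≠ b := by rintro rfl; exact nvq h.ab
  have hqe : q ≠ e := by rintro rfl; exact nvq h.ea.symm
  have hrb : r ≠ b := by rintro rfl; exact nrv h.ab.symm
  have hre : r ≠ e := by rintro rfl; exact nrv h.ea
  -- The remaining coincidences between the pentagons would give a second triangle on `s b`, or a
  -- 4-cycle through `s b` or `v e`; these edges lie in the triangles `s b v` and `v e w`.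
  have hrc : r ≠ c := by
    rintro rfl
    exact k.da (hG.triangle_unique s b v r hsb k.ea h.ab.symm k.de.symm h.bc).symm
  have hqc : q ≠ c := by
    rintro rfl
    exact hG.triangle_four_cycle s b v q r hsb k.ea h.ab.symm h.bc k.cd k.de k.ce hrb
  have hrd : r ≠ d := by
    rintro rfl
    exact hG.triangle_four_cycle s b v c r hsb k.ea h.ab.symm h.bc h.cd k.de hsc.symm hrb
  have hqd : q ≠ d := by
    rintro rfl
    exact hG.triangle_four_cycle v e w q p h.ea.symm hwv hwe h.de.symm k.bc.symm k.ab.symm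
      k.ac.symm hpe
  have nep : ¬ G.Adj e p := fun hep =>
    hpw (hG.triangle_unique v e p w h.ea.symm k.ab hep hwv hwe)
  have nes : ¬ G.Adj e s := fun hes =>
    h.eb (hG.triangle_unique v s e b k.ea.symm h.ea.symm hes.symm h.ab hsb)
  have neq : ¬ G.Adj e q := fun heq =>
    hG.triangle_four_cycle v e w q p h.ea.symm hwv hwe heq k.bc.symm k.ab.symm k.ac.symm hpe
  have ner : ¬ G.Adj e r := fun her =>
    hG.triangle_four_cycle v e w r s h.ea.symm hwv hwe her k.de k.ea k.da hse
  -- Walk around both pentagons, crossing from one to the other along `s b`. Of the five neighbours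
  -- of `v` four are on this cycle, but of the four of `e` only `v` and `d`.
  refine hG.false_of_cycle_of_card v e [p, q, r, s, b, c, d] {b, e, p, s} {v, d} ?_ ?_ h.ea ?_ he
    ?_ ?_ ?_
  · simp [k.ab.ne, k.ac, k.da.symm, k.ea.ne', h.ab.ne, h.ac, h.da.symm, h.ea.ne',
      k.bc.ne, k.bd, k.eb.symm, hpb, hpc, hpd, hpe, k.cd.ne, k.ce, hqb, hqc, hqd, hqe,
      k.de.ne, hrb, hrc, hrd, hre, hsb.ne, hsc, hsd, hse, h.bc.ne, h.bd, h.eb.symm,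
      h.cd.ne, h.ce, h.de.ne]
  · simp [k.ab, k.bc, k.cd, k.de, hsb, h.bc, h.cd, h.de]
  · simp [hp, hq, hr, hs, hb, hc, hd]
  · simp [h.ab, h.ea.symm, k.ab, k.ea.symm]
  · intro z hz hez
    simp only [List.cons_append, List.nil_append, List.mem_cons, List.not_mem_nil, or_false] at hz
    rcases hz with rfl | rfl | rfl | rfl | rfl | rfl | rfl | rfl | rfl
    · simp
    · exact (nep hez).elim
    · exact (neq hez).elim
    · exact (ner hez).elim
    · exact (nes hez).elim
    · exact (neb hez).elim
    · exact (nce hez.symm).elim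
    · simp
    · exact (hez.ne rfl).elim
  · have h4 : ({b, e, p, s} : Finset V).card = 4 := by
      rw [Finset.card_insert_of_notMem, Finset.card_eq_three.2 ⟨e, p, s, hpe.symm, hse.symm,
        k.eb.symm, rfl⟩]
      simp [h.eb.symm, hpb.symm, hsb.ne']
    have := Finset.card_le_two (a := v) (b := d)
    omega

end IsCriticalLike

end SimpleGraph

/-! ### Rotation systems and facial walks. -/

/-- A sum is nonnegative if its averages over the iterates of a permutation are. -/
theorem Equiv.Perm.sum_nonneg_of_average {D : Type*} [Fintype D] (g : Equiv.Perm D) (p : D → Prop)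
    [DecidablePred p] (hp : ∀ d, p (g d) ↔ p d) (n : ℕ) (hn : 0 < n) (F : D → ℚ)
    (h : ∀ d, p d → 0 ≤ ∑ i ∈ Finset.range n, F ((g ^ i) d)) :
    0 ≤ ∑ d with p d, F d := by
  have hpi : ∀ i d, p ((g ^ i) d) ↔ p d := by
    intro i
    induction i with
    | zero => simp
    | succ i ih => intro d; rw [pow_succ', Equiv.Perm.mul_apply, hp, ih]
  have h1 : ∀ i, ∑ d with p d, F ((g ^ i) d) = ∑ d with p d, F d := fun i =>
    Finset.sum_equiv (g ^ i) (by simp [hpi]) (by simp)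
  have h2 : ∑ d with p d, ∑ i ∈ Finset.range n, F ((g ^ i) d) = n * ∑ d with p d, F d := by
    rw [Finset.sum_comm]
    simp [h1]
  have h3 : 0 ≤ ∑ d with p d, ∑ i ∈ Finset.range n, F ((g ^ i) d) :=
    Finset.sum_nonneg fun d hd => h d (Finset.mem_filter.1 hd).2
  rw [h2] at h3
  have : (0 : ℚ) < n := by exact_mod_cast hn
  exact nonneg_of_mul_nonneg_right h3 this

namespace SimpleGraph

/-- A rotation system: a cyclic order of the darts at every vertex. -/
structure RotationSystem {V : Type u} (G : SimpleGraph V) where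
  /-- the next dart at the same vertex -/
  next : Equiv.Perm G.Dart
  fst_next : ∀ d, (next d).fst = d.fst
  sameCycle : ∀ d d' : G.Dart, d.fst = d'.fst → next.SameCycle d d'

namespace RotationSystem

variable {V : Type u} {G : SimpleGraph V} (R : G.RotationSystem)

/-- The permutation whose cycles are the facial walks. -/
def face : Equiv.Perm G.Dart :=
  (Function.Involutive.toPerm Dart.symm Dart.symm_involutive).trans R.next

theorem face_apply (d : G.Dart) : R.face d = R.next d.symm := rfl

theorem face_symm_apply (d : G.Dart) : R.face d.symm = R.next d := by
  rw [face_apply, Dart.symm_symm]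

@[simp] theorem fst_face (d : G.Dart) : (R.face d).fst = d.snd := R.fst_next _

theorem fst_next_symm (d : G.Dart) : (R.next.symm d).fst = d.fst := by
  rw [← R.fst_next (R.next.symm d), Equiv.apply_symm_apply]

/-- The facial walk of `d` is a triangle. -/
def Tri (d : G.Dart) : Prop := R.face (R.face (R.face d)) = d

/-- The facial walk of `d` has length five. -/
def Pent (d : G.Dart) : Prop := R.face (R.face (R.face (R.face (R.face d)))) = d

theorem tri_face (d : G.Dart) : R.Tri (R.face d) ↔ R.Tri d := by simp [Tri]

theorem pent_face (d : G.Dart) : R.Pent (R.face d) ↔ R.Pent d := by simp [Pent]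

theorem adj_fst_face (d : G.Dart) : G.Adj d.fst (R.face d).fst := by
  rw [R.fst_face]
  exact d.adj

variable {R}

/-- The triangle of `a` fills the corner between `next.symm a` and `a`, so its third vertex is the
end of `next.symm a`. -/
theorem Tri.symm_face_face {a : G.Dart} (h : R.Tri a) :
    (R.face (R.face a)).symm = R.next.symm a := by
  rw [Equiv.eq_symm_apply, ← R.face_apply]
  exact h

theorem Tri.snd_face {a : G.Dart} (h : R.Tri a) : (R.face a).snd = (R.next.symm a).snd := by
  rw [← h.symm_face_face, ← R.fst_face (R.face a)]
  rfl

theorem Tri.adj {a : G.Dart} (h : R.Tri a) : G.Adj a.snd (R.next.symm a).snd := by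
  rw [← h.snd_face, ← R.fst_face a]
  exact (R.face a).adj

theorem adj_fst_snd_next_symm (a : G.Dart) : G.Adj a.fst (R.next.symm a).snd := by
  rw [← R.fst_next_symm a]
  exact (R.next.symm a).adj

theorem Pent.symm_face {d : G.Dart} (h : R.Pent d) :
    R.face.symm d = R.face (R.face (R.face (R.face d))) := by
  rw [Equiv.symm_apply_eq]
  exact h.symm

theorem dart_eq_of_fst_snd {d e : G.Dart} (h1 : d.fst = e.fst) (h2 : d.snd = e.snd) : d = e :=
  Dart.ext _ _ (Prod.ext h1 h2)

variable [Fintype V] [DecidableRel G.Adj]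

/-- The number of vertices of degree at least five on a facial walk of length five. -/
def bigCount (R : G.RotationSystem) (d : G.Dart) : ℕ :=
  let b : G.Dart → ℕ := fun e => if 5 ≤ G.degree e.fst then 1 else 0
  b d + b (R.face d) + b (R.face (R.face d)) + b (R.face (R.face (R.face d))) +
    b (R.face (R.face (R.face (R.face d))))

theorem Pent.bigCount_face {d : G.Dart} (h : R.Pent d) : R.bigCount (R.face d) = R.bigCount d := by
  simp only [bigCount]
  rw [h]
  ring

theorem two_le_bigCount {d : G.Dart} (h1 : 5 ≤ G.degree d.fst)
    (h2 : 5 ≤ G.degree (R.face (R.face d)).fst) : 2 ≤ R.bigCount d := by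
  simp only [bigCount, if_pos h1, if_pos h2]
  omega

variable [DecidableEq V]

-- `next` is one cycle on the darts at a vertex, and their number is the degree.
variable (R) in
theorem next_pow_apply_eq (d : G.Dart) (n : ℕ) :
    (R.next ^ n) d = d ↔ G.degree d.fst ∣ n := by
  have hc : R.next.IsCycleOn (({e : G.Dart | e.fst = d.fst} : Finset G.Dart) : Set G.Dart) := by
    refine ⟨⟨fun e he => ?_, R.next.injective.injOn, fun e he => ?_⟩, fun e he e' he' => ?_⟩
    · simpa [R.fst_next] using he
    · refine ⟨R.next.symm e, ?_, by simp⟩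
      simpa [R.fst_next_symm] using he
    · simp only [Finset.coe_filter, Finset.mem_univ, true_and, Set.mem_ofPred_eq] at he he'
      exact R.sameCycle _ _ (he.trans he'.symm)
  rw [hc.pow_apply_eq (by simp), G.dart_fst_fiber_card_eq_degree]

section

variable (hG : G.IsCriticalLike)

include hG

theorem next_ne (d : G.Dart) : R.next d ≠ d := fun h => by
  have h1 := (R.next_pow_apply_eq d 1).1 (by simpa using h)
  have := Nat.le_of_dvd (by norm_num) h1
  have := hG.four_le_degree d.fst
  omega

theorem next_next_ne (d : G.Dart) : R.next (R.next d) ≠ d := fun h => by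
  have h1 := (R.next_pow_apply_eq d 2).1 (by simpa [pow_succ] using h)
  have := Nat.le_of_dvd (by norm_num) h1
  have := hG.four_le_degree d.fst
  omega

/-- A facial walk that turned straight back would give a fixed point of `next`. On closed facial
walks of length four or five this and adjacency are all that is needed for the vertices to be
distinct. -/
theorem fst_ne_snd_face (d : G.Dart) : d.fst ≠ (R.face d).snd := fun h =>
  next_ne hG (R := R) d.symm (dart_eq_of_fst_snd (R.fst_face d) h.symm)

theorem fst_ne_fst_face_face (d : G.Dart) : d.fst ≠ (R.face (R.face d)).fst := by
  rw [R.fst_face]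
  exact fst_ne_snd_face hG d

theorem Pent.fiveCycle {d : G.Dart} (h : R.Pent d) :
    G.FiveCycle d.fst (R.face d).fst (R.face (R.face d)).fst (R.face (R.face (R.face d))).fst
      (R.face (R.face (R.face (R.face d)))).fst where
  ab := R.adj_fst_face _
  bc := R.adj_fst_face _
  cd := R.adj_fst_face _
  de := R.adj_fst_face _
  ea := by
    have := R.adj_fst_face (R.face (R.face (R.face (R.face d))))
    rwa [h] at this
  ac := fst_ne_fst_face_face hG _
  bd := fst_ne_fst_face_face hG _
  ce := fst_ne_fst_face_face hG _
  da := by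
    have := fst_ne_fst_face_face hG (R := R) (R.face (R.face (R.face d)))
    rwa [h] at this
  eb := by
    have := fst_ne_fst_face_face hG (R := R) (R.face (R.face (R.face (R.face d))))
    rwa [h] at this

/-- By `triangle_unique` facial triangles on both sides of an edge have the same third vertex, so
`next a` and `next.symm a` agree, which is impossible at a vertex of degree at least four. -/
theorem not_tri_symm {a : G.Dart} (h : R.Tri a) : ¬ R.Tri a.symm := fun h' => by
  have h1 : (R.next.symm a).snd = (R.next.symm a.symm).snd :=
    hG.triangle_unique a.fst a.snd _ _ a.adj (adj_fst_snd_next_symm a) h.adj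
      h'.adj (adj_fst_snd_next_symm a.symm)
  have h2 : (R.next a).snd = (R.next.symm a).snd := by
    rw [h1, ← h'.snd_face, R.face_symm_apply]
  have h3 : R.next a = R.next.symm a :=
    dart_eq_of_fst_snd ((R.fst_next a).trans (R.fst_next_symm a).symm) h2
  exact next_next_ne hG a (by rw [h3, Equiv.apply_symm_apply])

theorem not_tri_symm_of_quad {d : G.Dart} (h : R.face (R.face (R.face (R.face d))) = d) :
    ¬ R.Tri d.symm := fun h' => by
  have h3 : G.Adj (R.face (R.face (R.face d))).fst d.fst := by
    have := R.adj_fst_face (R.face (R.face (R.face d)))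
    rwa [h] at this
  have h4 : (R.face (R.face (R.face d))).fst ≠ d.snd := by
    rw [← R.fst_face d]
    exact (fst_ne_fst_face_face hG _).symm
  have h5 := R.adj_fst_face (R.face d)
  rw [R.fst_face d] at h5
  exact hG.triangle_four_cycle d.fst d.snd _ (R.face (R.face d)).fst
    (R.face (R.face (R.face d))).fst d.adj h'.adj (adj_fst_snd_next_symm d.symm) h5
    (R.adj_fst_face _) h3 (fst_ne_fst_face_face hG d).symm h4

end

/-- The face of `d` has length five and only vertices of degree four, and `d` is the middle edge
of three consecutive edges of the face which are in facial triangles. -/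
def Opp (R : G.RotationSystem) (d : G.Dart) : Prop :=
  R.Pent d ∧ R.bigCount d = 0 ∧ R.Tri d.symm ∧ R.Tri (R.face d).symm ∧ R.Tri (R.face.symm d).symm

theorem degree_eq_four_of_bigCount_eq_zero (hG : G.IsCriticalLike) {d : G.Dart}
    (h : R.bigCount d = 0) : G.degree d.fst = 4 ∧ G.degree (R.face d).fst = 4 ∧
      G.degree (R.face (R.face d)).fst = 4 ∧ G.degree (R.face (R.face (R.face d))).fst = 4 ∧
      G.degree (R.face (R.face (R.face (R.face d)))).fst = 4 := by
  have h4 := hG.four_le_degree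
  simp only [bigCount, Nat.add_eq_zero_iff, ite_eq_right_iff, one_ne_zero, imp_false, not_le] at h
  refine ⟨?_, ?_, ?_, ?_, ?_⟩ <;> refine le_antisymm ?_ (h4 _) <;> omega

theorem degree_eq_four_of_bigCount_eq_one (hG : G.IsCriticalLike) {d : G.Dart}
    (h : R.bigCount d = 1) (hd : 5 ≤ G.degree d.fst) : G.degree (R.face d).fst = 4 ∧
      G.degree (R.face (R.face d)).fst = 4 ∧ G.degree (R.face (R.face (R.face d))).fst = 4 ∧
      G.degree (R.face (R.face (R.face (R.face d)))).fst = 4 := by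
  have h4 := hG.four_le_degree
  simp only [bigCount, if_pos hd] at h
  have h' : ∀ {p q r s : ℕ}, 1 + p + q + r + s = 1 → p = 0 ∧ q = 0 ∧ r = 0 ∧ s = 0 := by omega
  obtain ⟨h1, h2, h3, h5⟩ := h' h
  simp only [ite_eq_right_iff, one_ne_zero, imp_false, not_le] at h1 h2 h3 h5
  refine ⟨?_, ?_, ?_, ?_⟩ <;> refine le_antisymm ?_ (h4 _) <;> omega

section

variable (hG : G.IsCriticalLike)

include hG

/-- This guarantees that the extra 1/6 of an `Opp` edge is paid by a big vertex. -/
theorem five_le_degree_apex {d : G.Dart} (hd : R.Pent d) (h0 : R.bigCount d = 0)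
    (ht : R.Tri d.symm) : 5 ≤ G.degree (R.next d).snd := by
  obtain ⟨ha, hb, hc, hd', he⟩ := degree_eq_four_of_bigCount_eq_zero hG h0
  have h1 := ht.adj
  rw [← ht.snd_face, R.face_symm_apply] at h1
  have h2 := adj_fst_snd_next_symm (R := R) d.symm
  rw [← ht.snd_face, R.face_symm_apply] at h2
  have := hG.degree_apex_ne_four (hd.fiveCycle hG) h1.symm
    (by rw [R.fst_face]; exact h2.symm) ha hb hc hd' he
  have := hG.four_le_degree (R.next d).snd
  omega

/-- Since `a.snd` has degree four, its darts in order are `a.symm`, `face a`, the next edge of the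
opposite pentagon, and one more dart. That last one leads to the apex of the triangle on the next
edge, which is big. It precedes `a.symm`, so the apex and `a.fst` both lie on the face of `a.symm`.
-/
theorem Tri.two_le_bigCount_symm {a : G.Dart} (hv : 5 ≤ G.degree a.fst)
    (hO : R.Opp (R.face a).symm) (hP : R.Pent a.symm) : 2 ≤ R.bigCount a.symm := by
  obtain ⟨hz, hz0, -, hz2, -⟩ := hO
  have e1 : R.face (R.face a).symm = R.next (R.next a.symm) := by
    rw [R.face_symm_apply, R.face_apply]
  have hapex := five_le_degree_apex hG (d := R.face (R.face a).symm) ((R.pent_face _).2 hz)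
    (hz.bigCount_face.trans hz0) hz2
  rw [e1] at hapex
  obtain ⟨-, h4, -⟩ := degree_eq_four_of_bigCount_eq_zero hG hz0
  rw [R.fst_face] at h4
  have e2 : (R.face a).symm.snd = a.symm.fst := R.fst_face a
  rw [e2] at h4
  have hpow := (R.next_pow_apply_eq a.symm 4).2 (by rw [h4])
  simp only [pow_succ, pow_zero, one_mul, Equiv.Perm.mul_apply] at hpow
  set q := (R.next (R.next (R.next a.symm))).symm with hq
  have hqf : R.face q = a.symm := by
    rw [R.face_apply, hq, Dart.symm_symm, hpow]
  have hPq : R.Pent q := by rwa [← R.pent_face, hqf]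
  rw [← hqf, hPq.bigCount_face]
  refine two_le_bigCount hapex ?_
  rw [hqf, R.fst_face]
  exact hv

/-- Mirror image of `Tri.two_le_bigCount_symm`, at the other end of the edge opposite to `a.fst`. -/
theorem Tri.two_le_bigCount_next_symm {a : G.Dart} (ha : R.Tri a) (hv : 5 ≤ G.degree a.fst)
    (hO : R.Opp (R.face a).symm) : 2 ≤ R.bigCount (R.next.symm a) := by
  obtain ⟨hz, hz0, -, -, hz2⟩ := hO
  set z := (R.face a).symm with hzdef
  have e1 : (R.face.symm z).symm = R.next.symm z := by
    rw [Equiv.eq_symm_apply, ← R.face_apply, Equiv.apply_symm_apply]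
  have hP' : R.Pent (R.face.symm z) := by
    rw [← R.pent_face, Equiv.apply_symm_apply]; exact hz
  have hapex := five_le_degree_apex hG (d := R.face.symm z) hP'
    (by rw [← hP'.bigCount_face, Equiv.apply_symm_apply]; exact hz0) hz2
  rw [← R.face_symm_apply, hz2.snd_face, e1] at hapex
  obtain ⟨h4, -⟩ := degree_eq_four_of_bigCount_eq_zero hG hz0
  have hpow := (R.next_pow_apply_eq z 4).2 (by rw [h4])
  simp only [pow_succ, pow_zero, one_mul, Equiv.Perm.mul_apply] at hpow
  have e2 : R.next (R.next z) = R.next.symm (R.next.symm z) := by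
    rw [Equiv.eq_symm_apply, Equiv.eq_symm_apply, hpow]
  have e3 : R.face (R.next.symm a) = R.next (R.next z) := by
    rw [← ha.symm_face_face, R.face_symm_apply, hzdef, ← R.face_apply (R.face a)]
  refine two_le_bigCount ?_ ?_
  · rwa [R.fst_next_symm]
  · rw [R.fst_face, e3, e2]
    exact hapex

/-- At a 5-vertex with two facial triangles, one face lies between them on one side and two faces on
the other. If the first is a pentagon with no other big vertex, then neither of the other two is.
Each of those is separated from it by one triangle, while the other triangle sits on its next edge,
so `false_of_two_fiveCycles` applies, in one orientation or the other. -/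
theorem not_pent_of_next_next_of_tri {a b : G.Dart} (ha : R.Tri a) (hb : R.Tri b)
    (hv : G.degree a.fst = 5) (hab : R.next (R.next a) = b) (hf : R.Pent a.symm)
    (hf1 : R.bigCount a.symm = 1) :
    ¬ (R.Pent b.symm ∧ R.bigCount b.symm = 1) ∧
    ¬ (R.Pent (R.next.symm a) ∧ R.bigCount (R.next.symm a) = 1) := by
  have n30 : R.next b ≠ a := fun h => by
    have h3 := (R.next_pow_apply_eq a 3).1 (by simp [pow_succ, hab, h])
    rw [hv] at h3
    omega
  have hpow := (R.next_pow_apply_eq a 5).2 (by rw [hv])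
  simp only [pow_succ, pow_zero, one_mul, Equiv.Perm.mul_apply] at hpow
  rw [hab] at hpow
  have hinj : ∀ {d e : G.Dart}, d ≠ e → d.fst = a.fst → e.fst = a.fst → d.snd ≠ e.snd :=
    fun h h1 h2 h3 => h (dart_eq_of_fst_snd (h1.trans h2.symm) h3)
  set a1 := R.next a with ha1
  set a3 := R.next b with ha3
  have f1 : a1.fst = a.fst := R.fst_next a
  have f2 : b.fst = a.fst := by rw [← hab, R.fst_next, f1]
  have f3 : a3.fst = a.fst := (R.fst_next b).trans f2
  have ea4 : R.next.symm a = R.next a3 := by rw [Equiv.symm_apply_eq, hpow]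
  have f4 : (R.next a3).fst = a.fst := (R.fst_next a3).trans f3
  have eb1 : R.next.symm b = a1 := by rw [Equiv.symm_apply_eq, hab]
  have n31 : a3 ≠ a1 := fun h => next_next_ne hG (R := R) a1 (by rw [hab, ← ha3, h])
  have n32 : a3 ≠ b := next_ne hG b
  have n34 : a3 ≠ R.next a3 := (next_ne hG a3).symm
  have hD : R.face a.symm = a1 := R.face_symm_apply a
  have hPD : R.Pent a1 := by rw [← hD, R.pent_face]; exact hf
  have hD1 : R.bigCount a1 = 1 := by rw [← hD, hf.bigCount_face, hf1]
  have cD := hPD.fiveCycle hG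
  obtain ⟨g1, g2, g3, g4⟩ := degree_eq_four_of_bigCount_eq_one hG hD1 (by rw [f1, hv])
  have hDlast : (R.face (R.face (R.face (R.face a1)))).fst = a.snd := by
    rw [← hD, hf]; rfl
  rw [hDlast, f1] at cD
  rw [hDlast] at g4
  have hadjb := hb.adj
  rw [eb1] at hadjb
  have hadja := ha.adj
  rw [ea4] at hadja
  constructor
  · rintro ⟨hP, h1⟩
    have hE : R.face b.symm = a3 := R.face_symm_apply b
    have hPE : R.Pent a3 := by rw [← hE, R.pent_face]; exact hP
    have hE1 : R.bigCount a3 = 1 := by rw [← hE, hP.bigCount_face, h1]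
    have cE := hPE.fiveCycle hG
    obtain ⟨k1, k2, k3, k4⟩ := degree_eq_four_of_bigCount_eq_one hG hE1 (by rw [f3, hv])
    have hElast : (R.face (R.face (R.face (R.face a3)))).fst = b.snd := by
      rw [← hE, hP]; rfl
    rw [hElast, f3] at cE
    rw [hElast] at k4
    refine hG.false_of_two_fiveCycles cD cE (w := (R.next a3).snd) ?_ ?_ hadja ?_ ?_ hv
      g1 g2 g3 g4 k1 k2 k3 k4
    · rw [R.fst_face]; exact hadjb
    · rw [← f4]; exact (R.next a3).adj
    · rw [R.fst_face]; exact hinj n34 f3 f4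
    · rw [R.fst_face]; exact hinj n30 f3 rfl
  · rintro ⟨hP, h1⟩
    rw [ea4] at hP h1
    have cE := hP.fiveCycle hG
    obtain ⟨k1, k2, k3, k4⟩ := degree_eq_four_of_bigCount_eq_one hG h1 (by rw [f4, hv])
    have hElast : (R.face (R.face (R.face (R.face (R.next a3))))).fst = a3.snd := by
      rw [← hP.symm_face]
      have : R.face.symm (R.next a3) = a3.symm := by
        rw [Equiv.symm_apply_eq, R.face_symm_apply]
      rw [this]; rfl
    rw [hElast, f4] at cE
    rw [hElast] at k4
    refine hG.false_of_two_fiveCycles cD.reverse cE.reverse (w := b.snd) ?_ ?_ ?_ ?_ ?_ hv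
      g4 g3 g2 g1 k4 k3 k2 k1
    · rw [R.fst_face]; exact hadja.symm
    · rw [← f2]; exact b.adj
    · rw [R.fst_face]; exact hadjb.symm
    · exact hinj n32 f3 f2
    · rw [R.fst_face]; exact hinj n31 f3 f1

end

end RotationSystem

end SimpleGraph

/-! ### Discharging rules and the charge of the vertices. -/

namespace SimpleGraph.RotationSystem

variable {V : Type u} {G : SimpleGraph V} {R : G.RotationSystem}

theorem tri_next_iff (a : G.Dart) : R.Tri (R.next a) ↔ R.Tri a.symm := by
  rw [← R.face_symm_apply, R.tri_face]

theorem tri_next_symm_symm_iff (a : G.Dart) : R.Tri (R.next.symm a).symm ↔ R.Tri a := by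
  rw [← R.tri_face, R.face_symm_apply, Equiv.apply_symm_apply]

variable (R) [Fintype V] [DecidableRel G.Adj]

theorem degree_next_pow (i : ℕ) (d : G.Dart) :
    G.degree ((R.next ^ i) d).fst = G.degree d.fst := by
  have : ((R.next ^ i) d).fst = d.fst := by
    induction i with
    | zero => rfl
    | succ i ih => rw [pow_succ', Equiv.Perm.mul_apply, R.fst_next, ih]
  rw [this]

theorem degree_next_symm (d : G.Dart) : G.degree (R.next.symm d).fst = G.degree d.fst := by
  rw [R.fst_next_symm]

open Classical in
/-- What a vertex of degree at least five gives to an incident face along an edge in a facial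
triangle. -/
noncomputable def share (d : G.Dart) : ℚ :=
  if R.Pent d then if R.bigCount d = 1 then 1 / 3 else 1 / 6 else 0

open Classical in
/-- What the first vertex of `a` gives through the triangle of `a`. -/
noncomputable def out (a : G.Dart) : ℚ :=
  if R.Tri a ∧ 5 ≤ G.degree a.fst then
    R.share a.symm + R.share (R.next.symm a) + if R.Opp (R.face a).symm then 1 / 6 else 0
  else 0

open Classical in
/-- What the face of `d` gets through the edge of `d`. -/
noncomputable def gain (d : G.Dart) : ℚ :=
  if R.Tri d.symm then
    (if 5 ≤ G.degree d.fst then R.share d else 0) + (if 5 ≤ G.degree d.snd then R.share d else 0) +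
      if R.Opp d then 1 / 6 else 0
  else 0

theorem share_nonneg (d : G.Dart) : 0 ≤ R.share d := by
  unfold share; split_ifs <;> norm_num

theorem share_le (d : G.Dart) : R.share d ≤ 1 / 3 := by
  unfold share; split_ifs <;> norm_num

theorem gain_nonneg (d : G.Dart) : 0 ≤ R.gain d := by
  have h1 := R.share_nonneg d
  unfold gain; split_ifs <;> linarith

variable {R}

theorem Pent.share_face {d : G.Dart} (h : R.Pent d) : R.share (R.face d) = R.share d := by
  rw [share, share, if_pos h, if_pos ((R.pent_face d).2 h), h.bigCount_face]

theorem share_le_of_two_le {d : G.Dart} (h : R.Pent d → 2 ≤ R.bigCount d) :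
    R.share d ≤ 1 / 6 := by
  unfold share
  split_ifs with h1 h2
  · have := h h1
    omega
  · norm_num
  · norm_num

theorem share_le_of_not {d : G.Dart} (h : ¬ (R.Pent d ∧ R.bigCount d = 1)) :
    R.share d ≤ 1 / 6 := by
  unfold share
  split_ifs with h1 h2
  · exact (h ⟨h1, h2⟩).elim
  · norm_num
  · norm_num

theorem out_eq_zero {a : G.Dart} (h : ¬ R.Tri a) : R.out a = 0 := if_neg fun h' => h h'.1

variable [DecidableEq V] (hG : G.IsCriticalLike)

include hG

theorem Tri.not_tri_next {a : G.Dart} (h : R.Tri a) : ¬ R.Tri (R.next a) := by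
  rw [tri_next_iff]
  exact not_tri_symm hG h

theorem out_le_of_opp {a : G.Dart} (h : R.Tri a) (hv : 5 ≤ G.degree a.fst)
    (hO : R.Opp (R.face a).symm) : R.share a.symm ≤ 1 / 6 ∧ R.share (R.next.symm a) ≤ 1 / 6 :=
  ⟨share_le_of_two_le (Tri.two_le_bigCount_symm hG hv hO),
    share_le_of_two_le fun _ => h.two_le_bigCount_next_symm hG hv hO⟩

/-- An opposite payment of 1/6 forces both shares down to 1/6, for 1/2 in all; otherwise there are
only two shares of at most 1/3. -/
theorem out_le (a : G.Dart) : R.out a ≤ 2 / 3 := by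
  unfold out
  split_ifs with h hO
  · have := out_le_of_opp hG h.1 h.2 hO
    linarith
  · have := R.share_le a.symm
    have := R.share_le (R.next.symm a)
    linarith
  · norm_num

/-- The face between the two triangles is paid through both of them. If its share is 1/3, the two
outer shares are at most 1/6; if it is 1/6, the outer ones may be 1/3. Either way the sum is at most
1, and an opposite payment of 1/6 is offset by smaller shares. -/
theorem out_add_out_le {a : G.Dart} (ha : R.Tri a) (hb : R.Tri (R.next (R.next a)))
    (hv : G.degree a.fst = 5) : R.out a + R.out (R.next (R.next a)) ≤ 1 := by
  have hv5 : 5 ≤ G.degree a.fst := hv.ge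
  have hfst : (R.next (R.next a)).fst = a.fst := by rw [R.fst_next, R.fst_next]
  have hvb : 5 ≤ G.degree (R.next (R.next a)).fst := by rw [hfst]; exact hv5
  have hmid : R.share (R.next.symm (R.next (R.next a))) = R.share a.symm := by
    rw [Equiv.symm_apply_apply, ← R.face_symm_apply]
    by_cases hP : R.Pent a.symm
    · exact hP.share_face
    · rw [share, share, if_neg hP, if_neg (by rwa [R.pent_face])]
  have key : R.share a.symm ≤ 1 / 6 ∨
      R.share (R.next (R.next a)).symm ≤ 1 / 6 ∧ R.share (R.next.symm a) ≤ 1 / 6 := by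
    by_cases h : R.Pent a.symm ∧ R.bigCount a.symm = 1
    · have := not_pent_of_next_next_of_tri hG ha hb hv rfl h.1 h.2
      exact Or.inr ⟨share_le_of_not this.1, share_le_of_not this.2⟩
    · exact Or.inl (share_le_of_not h)
  rw [show R.out a = _ from if_pos ⟨ha, hv5⟩,
    show R.out (R.next (R.next a)) = _ from if_pos ⟨hb, hvb⟩, hmid]
  have h1 := R.share_le a.symm
  have h2 := R.share_le (R.next.symm a)
  have h3 := R.share_le (R.next (R.next a)).symm
  split_ifs with hO1 hO2 hO2
  · have := out_le_of_opp hG ha hv5 hO1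
    have := out_le_of_opp hG hb hvb hO2
    linarith
  · have := out_le_of_opp hG ha hv5 hO1
    linarith
  · have := out_le_of_opp hG hb hvb hO2
    rw [hmid] at this
    linarith
  · rcases key with h | h <;> linarith

/-- Consecutive darts are never both triangular, so at most two of the five are, and two such darts
are two steps apart. -/
theorem out_five_le {a : G.Dart} (hv : G.degree a.fst = 5) :
    R.out a + R.out (R.next a) + R.out (R.next (R.next a)) + R.out (R.next (R.next (R.next a))) +
      R.out (R.next (R.next (R.next (R.next a)))) ≤ 1 := by
  have hpow := (R.next_pow_apply_eq a 5).2 (by rw [hv])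
  simp only [pow_succ, pow_zero, one_mul, Equiv.Perm.mul_apply] at hpow
  have hz : ∀ d : G.Dart, R.Tri d ∨ R.out d = 0 := fun d => by
    by_cases h : R.Tri d
    · exact Or.inl h
    · exact Or.inr (out_eq_zero h)
  have hle : ∀ d : G.Dart, R.out d ≤ 2 / 3 := out_le hG
  have hn : ∀ d : G.Dart, R.Tri d → ¬ R.Tri (R.next d) := fun d h => h.not_tri_next hG
  have h2 : ∀ d : G.Dart, d.fst = a.fst → R.Tri d → R.Tri (R.next (R.next d)) →
      R.out d + R.out (R.next (R.next d)) ≤ 1 := fun d hd h h' =>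
    out_add_out_le hG h h' (by rw [hd, hv])
  set b := R.next a with hb
  set c := R.next b with hc
  set d := R.next c with hd
  set e := R.next d with he
  have fb : b.fst = a.fst := R.fst_next a
  have fc : c.fst = a.fst := (R.fst_next b).trans fb
  have fd : d.fst = a.fst := (R.fst_next c).trans fc
  have fe : e.fst = a.fst := (R.fst_next d).trans fd
  have nab := hn a
  have nbc := hn b
  have ncd := hn c
  have nde := hn d
  have nea := hn e
  have sac := h2 a rfl
  have sbd := h2 b fb
  have sce := h2 c fc
  have sda := h2 d fd
  have seb := h2 e fe
  rw [hpow] at nea sda seb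
  have la := hle a
  have lb := hle b
  have lc := hle c
  have ld := hle d
  have le := hle e
  rcases hz a with ha0 | ha0 <;> rcases hz b with hb0 | hb0
  · exact (nab ha0 hb0).elim
  · rcases hz c with hc0 | hc0 <;> rcases hz d with hd0 | hd0 <;> rcases hz e with he0 | he0
    · exact (ncd hc0 hd0).elim
    · exact (ncd hc0 hd0).elim
    · exact (nea he0 ha0).elim
    · have := sac ha0 hc0; linarith
    · exact (nea he0 ha0).elim
    · have := sda hd0 ha0; linarith
    · exact (nea he0 ha0).elim
    · linarith
  · rcases hz c with hc0 | hc0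
    · exact (nbc hb0 hc0).elim
    rcases hz d with hd0 | hd0 <;> rcases hz e with he0 | he0
    · exact (nde hd0 he0).elim
    · have := sbd hb0 hd0; linarith
    · have := seb he0 hb0; linarith
    · linarith
  · rcases hz c with hc0 | hc0 <;> rcases hz d with hd0 | hd0 <;> rcases hz e with he0 | he0
    · exact (ncd hc0 hd0).elim
    · exact (ncd hc0 hd0).elim
    · have := sce hc0 he0; linarith
    · linarith
    · exact (nde hd0 he0).elim
    · linarith
    · linarith
    · linarith

theorem sum_out_le : ∑ d : G.Dart, R.out d ≤ ∑ d : G.Dart, (1 - 4 / (G.degree d.fst : ℚ)) := by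
  rw [← sub_nonneg, ← Finset.sum_sub_distrib]
  set F : G.Dart → ℚ := fun d => 1 - 4 / (G.degree d.fst : ℚ) - R.out d with hF
  have hFi : ∀ i d, F ((R.next ^ i) d) =
      1 - 4 / (G.degree d.fst : ℚ) - R.out ((R.next ^ i) d) := fun i d => by
    simp only [hF, degree_next_pow]
  have h5 : 0 ≤ ∑ d : G.Dart with G.degree d.fst = 5, F d := by
    refine R.next.sum_nonneg_of_average (fun d => G.degree d.fst = 5) (fun d => by rw [R.fst_next])
      5 (by norm_num) F fun d hd => ?_
    have := out_five_le hG (R := R) hd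
    simp only [hFi, hd, Finset.sum_range_succ, Finset.sum_range_zero, pow_succ, pow_zero, one_mul,
      Equiv.Perm.mul_apply, Equiv.Perm.one_apply]
    push_cast
    linarith
  -- Pairs of consecutive darts suffice here: at most one of them pays, and at most 2/3, which is
  -- twice `1 - 4 / 6`. Vertices of degree four have no charge and pay nothing.
  have h6 : 0 ≤ ∑ d : G.Dart with ¬ G.degree d.fst = 5, F d := by
    refine R.next.sum_nonneg_of_average (fun d => ¬ G.degree d.fst = 5)
      (fun d => by rw [R.fst_next]) 2 (by norm_num) F fun d hd => ?_
    simp only [hFi, Finset.sum_range_succ, Finset.sum_range_zero, pow_zero, pow_one,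
      Equiv.Perm.one_apply]
    have h4 := hG.four_le_degree d.fst
    rcases h4.eq_or_lt with h | h
    · have ho : ∀ e : G.Dart, e.fst = d.fst → R.out e = 0 := fun e he =>
        if_neg fun h' => by
          have := h'.2
          rw [he] at this
          omega
      rw [ho d rfl, ho (R.next d) (R.fst_next d), ← h]
      norm_num
    · have h6 : (6 : ℚ) ≤ G.degree d.fst := by
        norm_cast
        omega
      have h7 : 4 / (G.degree d.fst : ℚ) ≤ 2 / 3 := by
        rw [div_le_div_iff₀ (by linarith) (by norm_num)]
        linarith
      have h8 : R.out d + R.out (R.next d) ≤ 2 / 3 := by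
        by_cases ht : R.Tri d
        · rw [out_eq_zero (ht.not_tri_next hG)]
          linarith [out_le hG (R := R) d]
        · rw [out_eq_zero ht]
          linarith [out_le hG (R := R) (R.next d)]
      linarith
  have := Finset.sum_filter_add_sum_filter_not (Finset.univ : Finset G.Dart)
    (fun d => G.degree d.fst = 5) F
  linarith

/-- Double counting: seen from the triangle's corner at the payer, the three edges across which it
pays are those of `a.symm`, `next.symm a` and `(face a).symm`, and each of these maps permutes the
darts. -/
theorem sum_gain_eq : ∑ d : G.Dart, R.gain d = ∑ a : G.Dart, R.out a := by
  classical
  set g1 : G.Dart → ℚ := fun d => if R.Tri d.symm ∧ 5 ≤ G.degree d.fst then R.share d else 0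
  set g2 : G.Dart → ℚ := fun d => if R.Tri d.symm ∧ 5 ≤ G.degree d.snd then R.share d else 0
  set g3 : G.Dart → ℚ := fun d => if R.Tri d.symm ∧ R.Opp d then 1 / 6 else 0
  have hg : ∀ d, R.gain d = g2 d + g1 d + g3 d := fun d => by
    simp only [gain, g1, g2, g3]
    split_ifs <;> first | tauto | ring
  have ho : ∀ a, R.out a = g2 a.symm + g1 (R.next.symm a) + g3 (R.face a).symm := fun a => by
    simp only [out, g1, g2, g3, Dart.symm_symm, tri_next_symm_symm_iff, degree_next_symm, R.tri_face]
    have e1 : a.symm.snd = a.fst := rfl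
    rw [e1]
    by_cases h : R.Tri a
    · by_cases hv : 5 ≤ G.degree a.fst
      · simp [h, hv]
      -- A small first vertex cannot be the apex over an `Opp` edge, so the test for degree five in
      -- `out` loses no payment.
      · have : ¬ R.Opp (R.face a).symm := fun hO => by
          have h5 := five_le_degree_apex hG hO.1 hO.2.1 hO.2.2.1
          rw [← R.face_apply, ← R.fst_face, show R.face (R.face (R.face a)) = a from h] at h5
          exact hv h5
        simp [h, hv, this]
    · simp [h]
  simp only [hg, ho, Finset.sum_add_distrib]
  congr 1
  · congr 1
    · exact (Equiv.sum_comp (Function.Involutive.toPerm Dart.symm Dart.symm_involutive) g2).symm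
    · exact (Equiv.sum_comp R.next.symm g1).symm
  · exact (Equiv.sum_comp (R.face.trans
      (Function.Involutive.toPerm Dart.symm Dart.symm_involutive)) g3).symm

end SimpleGraph.RotationSystem

/-! ### The charge of the faces. -/

/-- The final charge of a pentagon, where `t i` says that the edge from the `i`-th to the next
vertex is in a triangle, and `b i` says that the `i`-th vertex has degree at least five. -/
theorem pentagon_charge_nonneg (t₀ t₁ t₂ t₃ t₄ b₀ b₁ b₂ b₃ b₄ : Prop) [Decidable t₀] [Decidable t₁]
    [Decidable t₂] [Decidable t₃] [Decidable t₄] [Decidable b₀] [Decidable b₁] [Decidable b₂]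
    [Decidable b₃] [Decidable b₄] (n : ℕ) (s : ℚ)
    (hn : n = (if b₀ then 1 else 0) + (if b₁ then 1 else 0) + (if b₂ then 1 else 0) +
      (if b₃ then 1 else 0) + if b₄ then 1 else 0)
    (hs : s = if n = 1 then 1 / 3 else 1 / 6) (g₀ g₁ g₂ g₃ g₄ : ℚ)
    (h₀ : g₀ = if t₀ then (if b₀ then s else 0) + (if b₁ then s else 0) +
      (if n = 0 ∧ t₀ ∧ t₁ ∧ t₄ then 1 / 6 else 0) else 0)
    (h₁ : g₁ = if t₁ then (if b₁ then s else 0) + (if b₂ then s else 0) +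
      (if n = 0 ∧ t₁ ∧ t₂ ∧ t₀ then 1 / 6 else 0) else 0)
    (h₂ : g₂ = if t₂ then (if b₂ then s else 0) + (if b₃ then s else 0) +
      (if n = 0 ∧ t₂ ∧ t₃ ∧ t₁ then 1 / 6 else 0) else 0)
    (h₃ : g₃ = if t₃ then (if b₃ then s else 0) + (if b₄ then s else 0) +
      (if n = 0 ∧ t₃ ∧ t₄ ∧ t₂ then 1 / 6 else 0) else 0)
    (h₄ : g₄ = if t₄ then (if b₄ then s else 0) + (if b₀ then s else 0) +
      (if n = 0 ∧ t₄ ∧ t₀ ∧ t₃ then 1 / 6 else 0) else 0) :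
    ((if t₀ then 1 else 0) + (if t₁ then 1 else 0) + (if t₂ then 1 else 0) +
      (if t₃ then 1 else 0) + if t₄ then 1 else 0) / 3 ≤ 1 + g₀ + g₁ + g₂ + g₃ + (g₄ : ℚ) := by
  -- No big vertex: up to three triangular edges cost at most 1. Four of them need 1/3 more and have
  -- two middle edges; five need 2/3 more and get 5/6.
  by_cases h0 : n = 0
  · have hb : ¬ b₀ ∧ ¬ b₁ ∧ ¬ b₂ ∧ ¬ b₃ ∧ ¬ b₄ := by
      rw [h0] at hn
      refine ⟨?_, ?_, ?_, ?_, ?_⟩ <;> intro h <;> rw [if_pos h] at hn <;> omega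
    simp only [hb, if_false, h0, true_and, zero_add] at h₀ h₁ h₂ h₃ h₄
    rw [h₀, h₁, h₂, h₃, h₄]
    by_cases k0 : t₀ <;> by_cases k1 : t₁ <;> by_cases k2 : t₂ <;> by_cases k3 : t₃ <;>
      by_cases k4 : t₄ <;>
      simp only [k0, k1, k2, k3, k4, if_true, if_false, and_true, and_false, and_self] <;> norm_num
  -- With a big vertex the opposite payments vanish, and the claim becomes linear in the indicators
  -- of the `t i`, now relaxed to numbers in [0, 1].
  · have key : ∀ (t : Prop) [Decidable t] (x y : ℚ) (o : Prop) [Decidable o],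
        (if t then x + y + (if n = 0 ∧ o then 1 / 6 else 0) else 0) =
          (if t then 1 else 0) * (x + y) := by
      intro t _ x y o _
      by_cases ht : t <;> simp [ht, h0]
    rw [key] at h₀ h₁ h₂ h₃ h₄
    have hτ : ∀ (t : Prop) [Decidable t], (0 : ℚ) ≤ (if t then 1 else 0) ∧
        (if t then 1 else 0) ≤ (1 : ℚ) := by
      intro t _
      split_ifs <;> norm_num
    obtain ⟨l0, u0⟩ := hτ t₀
    obtain ⟨l1, u1⟩ := hτ t₁
    obtain ⟨l2, u2⟩ := hτ t₂
    obtain ⟨l3, u3⟩ := hτ t₃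
    obtain ⟨l4, u4⟩ := hτ t₄
    generalize (if t₀ then (1 : ℚ) else 0) = τ₀ at *
    generalize (if t₁ then (1 : ℚ) else 0) = τ₁ at *
    generalize (if t₂ then (1 : ℚ) else 0) = τ₂ at *
    generalize (if t₃ then (1 : ℚ) else 0) = τ₃ at *
    generalize (if t₄ then (1 : ℚ) else 0) = τ₄ at *
    rw [h₀, h₁, h₂, h₃, h₄]
    clear h₀ h₁ h₂ h₃ h₄ key hτ
    by_cases k0 : b₀ <;> by_cases k1 : b₁ <;> by_cases k2 : b₂ <;> by_cases k3 : b₃ <;>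
      by_cases k4 : b₄ <;>
      simp only [k0, k1, k2, k3, k4, if_true, if_false] at hn ⊢ <;>
      norm_num at hn <;> first
        | exact (h0 hn).elim
        | (rw [hn] at hs
           norm_num at hs
           rw [hs]
           linarith)

namespace SimpleGraph.RotationSystem

variable {V : Type u} {G : SimpleGraph V} {R : G.RotationSystem}

/-- The length of the facial walk of `d`. -/
noncomputable def len (R : G.RotationSystem) (d : G.Dart) : ℕ := Function.minimalPeriod R.face d

theorem iterate_len (d : G.Dart) : R.face^[R.len d] d = d :=
  Function.iterate_minimalPeriod

variable [Fintype V] [DecidableRel G.Adj]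

theorem len_pos (d : G.Dart) : 0 < R.len d :=
  Function.minimalPeriod_pos_of_mem_periodicPts (R.face.injective.mem_periodicPts d)

theorem Pent.gain_eq {d : G.Dart} (hd : R.Pent d) {T : G.Dart → Prop} (hT : ∀ e, T e ↔ R.Tri e.symm)
    [DecidablePred T] :
    R.gain d = if T d then (if 5 ≤ G.degree d.fst then R.share d else 0) +
      (if 5 ≤ G.degree (R.face d).fst then R.share d else 0) +
      (if R.bigCount d = 0 ∧ T d ∧ T (R.face d) ∧
        T (R.face (R.face (R.face (R.face d)))) then 1 / 6 else 0) else 0 := by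
  have h1 : R.Opp d ↔ R.bigCount d = 0 ∧ T d ∧ T (R.face d) ∧
      T (R.face (R.face (R.face (R.face d)))) := by
    simp only [Opp, hT, hd, true_and, hd.symm_face]
  have h2 : G.degree (R.face d).fst = G.degree d.snd := by rw [R.fst_face]
  unfold gain
  rw [h2]
  by_cases ht : T d
  · rw [if_pos ht, if_pos ((hT d).1 ht)]
    congr 1
    by_cases ho : R.Opp d
    · rw [if_pos ho, if_pos (h1.1 ho)]
    · rw [if_neg ho, if_neg (fun h => ho (h1.2 h))]
  · rw [if_neg ht, if_neg (fun h => ht ((hT d).2 h))]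

theorem Pent.charge_nonneg {d : G.Dart} (hd : R.Pent d) (T : G.Dart → Prop)
    (hT : ∀ e, T e ↔ R.Tri e.symm) [DecidablePred T] :
    0 ≤ ∑ i ∈ Finset.range 5, ((1 : ℚ) / 5 - (if T ((R.face ^ i) d) then 1 else 0) / 3 +
      R.gain ((R.face ^ i) d)) := by
  have hd1 := (R.pent_face d).2 hd
  have hd2 := (R.pent_face _).2 hd1
  have hd3 := (R.pent_face _).2 hd2
  have hd4 := (R.pent_face _).2 hd3
  have s1 := hd.share_face
  have s2 := hd1.share_face.trans s1
  have s3 := hd2.share_face.trans s2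
  have s4 := hd3.share_face.trans s3
  have n1 := hd.bigCount_face
  have n2 := hd1.bigCount_face.trans n1
  have n3 := hd2.bigCount_face.trans n2
  have n4 := hd3.bigCount_face.trans n3
  have g0 := hd.gain_eq hT
  have g1 := hd1.gain_eq hT
  have g2 := hd2.gain_eq hT
  have g3 := hd3.gain_eq hT
  have g4 := hd4.gain_eq hT
  have hd' : R.face (R.face (R.face (R.face (R.face d)))) = d := hd
  have e5 : G.degree (R.face (R.face (R.face (R.face (R.face d))))).fst = G.degree d.fst := by
    rw [hd']
  rw [e5] at g4
  simp only [hd', s1, s2, s3, s4, n1, n2, n3, n4] at g1 g2 g3 g4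
  have := pentagon_charge_nonneg _ _ _ _ _ _ _ _ _ _ (R.bigCount d) (R.share d) rfl
    (if_pos hd) _ _ _ _ _ g0 g1 g2 g3 g4
  simp only [Finset.sum_range_succ, Finset.sum_range_zero, pow_succ, pow_zero, one_mul,
    Equiv.Perm.mul_apply, Equiv.Perm.one_apply]
  linarith

variable [DecidableEq V] (hG : G.IsCriticalLike)

include hG

theorem three_le_len (d : G.Dart) : 3 ≤ R.len d := by
  have h0 := len_pos (R := R) d
  have h := iterate_len (R := R) d
  by_contra hlt
  have h12 : R.len d = 1 ∨ R.len d = 2 := by omega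
  rcases h12 with h' | h' <;> rw [h'] at h
  · have := R.adj_fst_face d
    rw [show R.face d = d from h] at this
    exact this.ne rfl
  · exact fst_ne_fst_face_face hG d (congrArg (fun e : G.Dart => e.fst)
      (show R.face (R.face d) = d from h)).symm

/-- This holds dart by dart: a triangle has -1/3, receives 1/3 and pays nothing; a 4-face has zero
and no triangular neighbour; from length six on there is at least 1/3 to give. -/
theorem charge_nonneg_of_not_pent (T : G.Dart → Prop)
    (hT : ∀ e, T e ↔ R.Tri e.symm) [DecidablePred T] {d : G.Dart} (hd : ¬ R.Pent d) :
    0 ≤ 1 - 4 / (R.len d : ℚ) - (if T d then 1 else 0) / 3 + (if T d.symm then 1 else 0) / 3 := by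
  have h0 := three_le_len hG (R := R) d
  have h := iterate_len (R := R) d
  have hn : (0 : ℚ) ≤ (if T d.symm then 1 else 0) := by split_ifs <;> norm_num
  have hn' : (if T d then (1 : ℚ) else 0) ≤ 1 := by split_ifs <;> norm_num
  by_cases h6 : 6 ≤ R.len d
  · have h6' : (6 : ℚ) ≤ R.len d := by exact_mod_cast h6
    have h7 : 4 / (R.len d : ℚ) ≤ 2 / 3 := by
      rw [div_le_div_iff₀ (by linarith) (by norm_num)]
      linarith
    linarith
  · have h345 : R.len d = 3 ∨ R.len d = 4 ∨ R.len d = 5 := by omega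
    rcases h345 with h' | h' | h' <;> rw [h'] at h
    · have ht : R.Tri d := h
      have h1 : ¬ T d := fun k => not_tri_symm hG ht ((hT d).1 k)
      have h2 : T d.symm := (hT _).2 (by rwa [Dart.symm_symm])
      rw [if_neg h1, if_pos h2, h']
      norm_num
    · have h1 : ¬ T d := fun k => not_tri_symm_of_quad hG h ((hT d).1 k)
      rw [if_neg h1, h']
      push_cast
      linarith
    · exact (hd h).elim

theorem Pent.len_eq {d : G.Dart} (hd : R.Pent d) : R.len d = 5 := by
  have h1 : R.len d ∣ 5 := Function.IsPeriodicPt.minimalPeriod_dvd (show R.face^[5] d = d from hd)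
  have h3 := three_le_len hG (R := R) d
  rcases (Nat.dvd_prime Nat.prime_five).1 h1 with h | h
  · omega
  · exact h

/-- The payments of 1/3 across edges cancel under reversal of darts, so they may be inserted into
the sum. Pentagons must be averaged over the walk; other faces need not be. -/
theorem sum_face_charge : 0 ≤ ∑ d : G.Dart, (1 - 4 / (R.len d : ℚ)) + ∑ d : G.Dart, R.gain d := by
  classical
  set T : G.Dart → Prop := fun e => R.Tri e.symm with hTdef
  have hT : ∀ e, T e ↔ R.Tri e.symm := fun e => Iff.rfl
  set F : G.Dart → ℚ := fun d => (1 - 4 / (R.len d : ℚ) - (if T d then 1 else 0) / 3 +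
    (if T d.symm then 1 else 0) / 3) + R.gain d with hF
  have h1 : 0 ≤ ∑ d : G.Dart with ¬ R.Pent d, F d := Finset.sum_nonneg fun d hd => by
    have := charge_nonneg_of_not_pent hG T hT (Finset.mem_filter.1 hd).2
    have := R.gain_nonneg d
    simp only [hF]
    linarith
  have h2 : 0 ≤ ∑ d : G.Dart with R.Pent d, F d := by
    refine le_trans (R.face.sum_nonneg_of_average R.Pent R.pent_face 5 (by norm_num)
      (fun d => (1 : ℚ) / 5 - (if T d then 1 else 0) / 3 + R.gain d)
      fun d hd => hd.charge_nonneg T hT) (Finset.sum_le_sum fun d hd => ?_)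
    have hd' := (Finset.mem_filter.1 hd).2
    simp only [hF, hd'.len_eq hG]
    have hn : (0 : ℚ) ≤ (if T d.symm then 1 else 0) := by split_ifs <;> norm_num
    push_cast
    linarith
  have h3 := Finset.sum_filter_add_sum_filter_not (Finset.univ : Finset G.Dart) R.Pent F
  have h4 : ∑ d : G.Dart, (if T d.symm then (1 : ℚ) else 0) / 3 =
      ∑ d : G.Dart, (if T d then (1 : ℚ) else 0) / 3 :=
    Equiv.sum_comp (Function.Involutive.toPerm Dart.symm Dart.symm_involutive)
      (fun d => (if T d then (1 : ℚ) else 0) / 3)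
  have h5 : ∑ d, F d = ∑ d : G.Dart, (1 - 4 / (R.len d : ℚ)) + ∑ d : G.Dart, R.gain d := by
    simp only [hF, Finset.sum_add_distrib, Finset.sum_sub_distrib, h4]
    ring
  linarith

omit hG

/-- Each fibre of `f` contains a whole cycle of `face`, on which `1 / len` sums to 1. Several facial
walks may share a fibre, hence only an inequality. -/
theorem card_le_sum_inv_len {K : Type*} [Fintype K] (f : G.Dart → K) (hf : Function.Surjective f)
    (hinv : ∀ d, f (R.face d) = f d) : (Fintype.card K : ℚ) ≤ ∑ d : G.Dart, 1 / (R.len d : ℚ) := by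
  classical
  have h1 : ∀ k, (1 : ℚ) ≤ ∑ d : G.Dart with f d = k, 1 / (R.len d : ℚ) := by
    intro k
    obtain ⟨d, rfl⟩ := hf k
    have hit : ∀ i, f (R.face^[i] d) = f d := by
      intro i
      induction i with
      | zero => rfl
      | succ i ih => rw [Function.iterate_succ_apply', hinv, ih]
    have hper : d ∈ Function.periodicPts R.face := R.face.injective.mem_periodicPts d
    have hlen : ∀ i, R.len (R.face^[i] d) = R.len d := fun i =>
      Function.minimalPeriod_apply_iterate hper i
    set O := (Finset.range (R.len d)).image (fun i => R.face^[i] d) with hO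
    have hinj : Set.InjOn (fun i => R.face^[i] d) (Finset.range (R.len d) : Set ℕ) := by
      intro i hi j hj hij
      simp only [Finset.coe_range, Set.mem_Iio] at hi hj
      exact (Function.iterate_eq_iterate_iff_of_lt_minimalPeriod hi hj).1 hij
    have hpos : (0 : ℚ) < R.len d := by exact_mod_cast len_pos (R := R) d
    calc (1 : ℚ) = ∑ d' ∈ O, 1 / (R.len d' : ℚ) := by
          rw [hO, Finset.sum_image hinj]
          simp only [hlen, Finset.sum_const, Finset.card_range, nsmul_eq_mul]
          field_simp
      _ ≤ _ := by
          refine Finset.sum_le_sum_of_subset_of_nonneg ?_ fun _ _ _ => by positivity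
          intro d' hd'
          obtain ⟨i, -, rfl⟩ := Finset.mem_image.1 hd'
          simp [hit]
  calc (Fintype.card K : ℚ) = ∑ _k : K, (1 : ℚ) := by simp
    _ ≤ ∑ k : K, ∑ d : G.Dart with f d = k, 1 / (R.len d : ℚ) := Finset.sum_le_sum fun k _ => h1 k
    _ = _ := Finset.sum_fiberwise _ _ _

include hG

/-- Euler's formula is contradicted by discharging. -/
theorem card_add_card_le {K : Type*} [Fintype K] (f : G.Dart → K) (hf : Function.Surjective f)
    (hinv : ∀ d, f (R.face d) = f d) : Fintype.card K + Fintype.card V ≤ G.edgeFinset.card := by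
  have h1 := sum_face_charge hG (R := R)
  have h2 := sum_out_le hG (R := R)
  rw [sum_gain_eq hG] at h1
  have h3 := card_le_sum_inv_len f hf hinv
  have h4 : ∑ d : G.Dart, 1 / (G.degree d.fst : ℚ) = Fintype.card V := by
    rw [← Finset.sum_fiberwise _ (fun d : G.Dart => d.fst)]
    have : ∀ v, ∑ d : G.Dart with d.fst = v, 1 / (G.degree d.fst : ℚ) = 1 := fun v => by
      rw [Finset.sum_congr rfl (g := fun _ => 1 / (G.degree v : ℚ)) fun d hd => by
        obtain rfl := (Finset.mem_filter.1 hd).2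
        rfl]
      rw [Finset.sum_const, G.dart_fst_fiber_card_eq_degree, nsmul_eq_mul]
      have : (0 : ℚ) < G.degree v := by
        have := hG.four_le_degree v
        exact_mod_cast (by omega : 0 < G.degree v)
      field_simp
    simp only [this]
    simp
  have h5 : (Fintype.card G.Dart : ℚ) = 2 * G.edgeFinset.card := by
    exact_mod_cast G.dart_card_eq_twice_card_edges
  have h6 : ∀ g : G.Dart → ℚ, ∑ d : G.Dart, (1 - 4 / g d) =
      Fintype.card G.Dart - 4 * ∑ d : G.Dart, 1 / g d := fun g => by
    rw [Finset.sum_sub_distrib, Finset.mul_sum]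
    simp [div_eq_mul_inv]
  -- Each side contributes the 2E darts minus four times its sum of reciprocals, so the two bounds
  -- add up to `0 ≤ 4 * (E - V - ∑ 1 / len)`.
  rw [h6] at h1 h2
  rw [h4] at h2
  rw [h5] at h1 h2
  have : (Fintype.card K : ℚ) + Fintype.card V ≤ G.edgeFinset.card := by linarith
  exact_mod_cast this

end SimpleGraph.RotationSystem

/-! ### Regions of a system of segments, by a vertical sweep. -/

open Filter Topology

/-- The number of classes of a relation that is given by finitely many pairs. -/
theorem card_le_card_quot_add {N P : Type*} [Fintype N] [Fintype P] (a b : P → N)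
    (r : N → N → Prop) (hr : ∀ u v, r u v → ∃ p, u = a p ∧ v = b p) [Fintype (Quot r)] :
    Fintype.card N ≤ Fintype.card (Quot r) + Fintype.card P := by
  classical
  -- The kernel of the difference map consists of functions constant on classes; its dimension is at
  -- least `|N| - |P|` by rank and nullity.
  let φ : (N → ℚ) →ₗ[ℚ] (P → ℚ) :=
    { toFun := fun g p => g (a p) - g (b p)
      map_add' := fun g g' => by ext p; simp; ring
      map_smul' := fun c g => by ext p; simp; ring }
  let ψ : LinearMap.ker φ →ₗ[ℚ] (Quot r → ℚ) :=
    { toFun := fun g => Quot.lift g.1 fun u v huv => by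
        obtain ⟨p, rfl, rfl⟩ := hr u v huv
        exact sub_eq_zero.1 (congrFun (LinearMap.mem_ker.1 g.2) p)
      map_add' := fun g g' => by ext q; induction q using Quot.ind; rfl
      map_smul' := fun c g => by ext q; induction q using Quot.ind; rfl }
  have hψ : Function.Injective ψ := fun g g' h => by
    ext u
    exact congrFun h (Quot.mk r u)
  have h1 := LinearMap.finrank_range_add_finrank_ker φ
  have h2 := LinearMap.finrank_le_finrank_of_injective hψ
  have h3 := Submodule.finrank_le (LinearMap.range φ)
  simp only [Module.finrank_fintype_fun_eq_card] at h1 h2 h3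
  omega

/-- The element of `O` with the largest key. -/
noncomputable def topOf {ι κ : Type*} [LinearOrder κ] (O : Finset ι) (key : ι → κ) : Option ι :=
  open Classical in
  if h : O.Nonempty then some (O.exists_max_image key h).choose else none

theorem topOf_empty {ι κ : Type*} [LinearOrder κ] (key : ι → κ) : topOf ∅ key = none := by
  simp [topOf]

theorem topOf_eq_some {ι κ : Type*} [LinearOrder κ] {O : Finset ι} {key : ι → κ}
    (hinj : Set.InjOn key O) {i : ι} (hi : i ∈ O) (h : ∀ j ∈ O, key j ≤ key i) :
    topOf O key = some i := by
  have hne : O.Nonempty := ⟨i, hi⟩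
  rw [topOf, dif_pos hne]
  obtain ⟨h1, h2⟩ := (O.exists_max_image key hne).choose_spec
  exact congrArg some (hinj h1 hi (le_antisymm (h _ h1) (h2 i hi)))

theorem topOf_congr {ι κ κ' : Type*} [LinearOrder κ] [LinearOrder κ'] {O : Finset ι} {key : ι → κ}
    {key' : ι → κ'} (hinj : Set.InjOn key O)
    (h : ∀ j ∈ O, ∀ k ∈ O, key j < key k ↔ key' j < key' k) : topOf O key = topOf O key' := by
  rcases O.eq_empty_or_nonempty with rfl | hne
  · rw [topOf_empty, topOf_empty]
  · obtain ⟨i, hi, hmax⟩ := O.exists_max_image key hne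
    have hinj' : Set.InjOn key' O := fun j hj k hk hjk => by
      refine hinj hj hk (le_antisymm ?_ ?_) <;> rw [← not_lt, h _ (by assumption) _ (by assumption)]
      · exact hjk.le.not_gt
      · exact hjk.ge.not_gt
    rw [topOf_eq_some hinj hi hmax, topOf_eq_some hinj' hi fun j hj => ?_]
    rw [← not_lt, ← h i hi j hj]
    exact (hmax j hj).not_gt

/-- `e'` follows `e` in the cyclic order of the elements with the same source. -/
def IsCyclicNext {D X κ : Type*} [LinearOrder κ] (src : D → X) (key : D → κ) (e e' : D) : Prop :=
  src e = src e' ∧ ((key e < key e' ∧ ∀ f, src f = src e → ¬ (key e < key f ∧ key f < key e')) ∨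
    ((∀ f, src f = src e → key f ≤ key e) ∧ ∀ f, src f = src e → key e' ≤ key f))

/-- Finitely many segments, none of them vertical, that meet only in common ends; the `i`-th one
is the graph of `x ↦ c i + m i * x` on `[a i, b i]`. -/
structure SegmentSystem (ι : Type*) where
  a : ι → ℝ
  b : ι → ℝ
  c : ι → ℝ
  m : ι → ℝ
  P : Finset (ℝ × ℝ)
  lt : ∀ i, a i < b i
  cross : ∀ i j x, i ≠ j → a i ≤ x → x ≤ b i → a j ≤ x → x ≤ b j →
    c i + m i * x = c j + m j * x → (x = a i ∨ x = b i)
  left_mem : ∀ i, (a i, c i + m i * a i) ∈ P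
  right_mem : ∀ i, (b i, c i + m i * b i) ∈ P
  injOn : ∀ p ∈ P, ∀ q ∈ P, p.1 = q.1 → p = q
  not_mem : ∀ p ∈ P, ∀ i, a i < p.1 → p.1 < b i → c i + m i * p.1 ≠ p.2

namespace SegmentSystem

variable {ι : Type*} [Fintype ι] (A : SegmentSystem ι)

/-- The height of the `i`-th segment over `x`. -/
def h (i : ι) (x : ℝ) : ℝ := A.c i + A.m i * x

/-- The segments over the points just to the right (`true`) or the left (`false`) of `x`. -/
noncomputable def overAt (s : Bool) (x : ℝ) : Finset ι :=
  open Classical in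
  {i | if s then A.a i ≤ x ∧ x < A.b i else A.a i < x ∧ x ≤ A.b i}

/-- This key orders the segments by their height just to the right or the left of `x`. -/
def key (s : Bool) (x : ℝ) (i : ι) : ℝ ×ₗ ℝ :=
  toLex (A.h i x, if s then A.m i else -A.m i)

variable {A}

theorem mem_over {s : Bool} {x : ℝ} {i : ι} : i ∈ A.overAt s x ↔
    if s then A.a i ≤ x ∧ x < A.b i else A.a i < x ∧ x ≤ A.b i := by
  simp [overAt]

omit [Fintype ι] in
theorem key_lt {s : Bool} {x : ℝ} {i j : ι} : A.key s x i < A.key s x j ↔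
    A.h i x < A.h j x ∨ A.h i x = A.h j x ∧
      if s then A.m i < A.m j else A.m j < A.m i := by
  cases s <;> simp [key, Prod.Lex.toLex_lt_toLex]

omit [Fintype ι] in
theorem key_le {s : Bool} {x : ℝ} {i j : ι} : A.key s x i ≤ A.key s x j ↔
    A.h i x < A.h j x ∨ A.h i x = A.h j x ∧
      if s then A.m i ≤ A.m j else A.m j ≤ A.m i := by
  cases s <;> simp [key, Prod.Lex.toLex_le_toLex]

theorem le_of_mem_over {s : Bool} {x : ℝ} {i : ι} (hi : i ∈ A.overAt s x) :
    A.a i ≤ x ∧ x ≤ A.b i := by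
  rw [mem_over] at hi
  cases s
  · exact ⟨hi.1.le, hi.2⟩
  · exact ⟨hi.1, hi.2.le⟩

theorem mem_over_of_lt {s : Bool} {x : ℝ} {i : ι} (h1 : A.a i < x) (h2 : x < A.b i) :
    i ∈ A.overAt s x := by
  rw [mem_over]
  cases s
  · exact ⟨h1, h2.le⟩
  · exact ⟨h1.le, h2⟩

/-- A segment over `x` either passes over `x`, or ends at `x`. -/
theorem lt_or_mem_of_mem_over {s : Bool} {x : ℝ} {i : ι} (hi : i ∈ A.overAt s x) :
    (A.a i < x ∧ x < A.b i) ∨ (x, A.h i x) ∈ A.P := by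
  obtain ⟨h1, h2⟩ := le_of_mem_over hi
  rcases h1.eq_or_lt with h | h
  · rw [← h]; exact Or.inr (A.left_mem i)
  · rcases h2.eq_or_lt with h' | h'
    · rw [h']; exact Or.inr (A.right_mem i)
    · exact Or.inl ⟨h, h'⟩

/-- Two segments with the same key lie on one line and overlap beside `x`, which `cross` forbids at
an inner point. -/
theorem key_injOn (s : Bool) (x : ℝ) : Set.InjOn (A.key s x) (A.overAt s x) := by
  intro i hi j hj hij
  by_contra hne
  have hh : A.h i x = A.h j x ∧ A.m i = A.m j := by
    simp only [key, EmbeddingLike.apply_eq_iff_eq, Prod.mk.injEq] at hij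
    cases s
    · simpa using hij
    · simpa using hij
  have hall : ∀ y, A.h i y = A.h j y := fun y => by
    have h1 := hh.1
    simp only [h] at h1 ⊢
    rw [hh.2] at h1 ⊢
    linarith
  rw [Finset.mem_coe, mem_over] at hi hj
  cases s
  · have hi' : A.a i < x ∧ x ≤ A.b i := hi
    have hj' : A.a j < x ∧ x ≤ A.b j := hj
    obtain ⟨y, hy1, hy2⟩ := exists_between (max_lt hi'.1 hj'.1)
    have h1 := (le_max_left _ _).trans_lt hy1
    have h2 := (le_max_right _ _).trans_lt hy1
    rcases A.cross i j y hne h1.le (hy2.le.trans hi'.2) h2.le (hy2.le.trans hj'.2) (hall y) with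
      hy | hy <;> linarith
  · have hi' : A.a i ≤ x ∧ x < A.b i := hi
    have hj' : A.a j ≤ x ∧ x < A.b j := hj
    obtain ⟨y, hy1, hy2⟩ := exists_between (lt_min hi'.2 hj'.2)
    have h1 := hy2.trans_le (min_le_left _ _)
    have h2 := hy2.trans_le (min_le_right _ _)
    rcases A.cross i j y hne (hi'.1.trans hy1.le) h1.le (hj'.1.trans hy1.le) h2.le (hall y) with
      hy | hy <;> linarith

omit [Fintype ι] in
theorem h_ne {i j : ι} {x : ℝ} (hne : i ≠ j) (h1 : A.a i < x) (h2 : x < A.b i)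
    (h3 : A.a j ≤ x) (h4 : x ≤ A.b j) : A.h i x ≠ A.h j x := fun hh => by
  rcases A.cross i j x hne h1.le h2.le h3 h4 hh with h | h
  · exact h1.ne' h
  · exact h2.ne h

variable (A)

/-- The segment on top just to the left or the right of `p` among those not above `p`. -/
noncomputable def topAt (s : Bool) (p : ℝ × ℝ) : Option ι :=
  topOf {i ∈ A.overAt s p.1 | A.h i p.1 ≤ p.2} (A.key s p.1)

/-- The regions: every segment stands for the region just above it, `none` for the one at the
bottom. -/
def Region : Type _ :=
  Quot fun u v : Option ι => ∃ p ∈ A.P, u = A.topAt false p ∧ v = A.topAt true p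

/-- The region of a segment or of the bottom. -/
def region (u : Option ι) : A.Region := Quot.mk _ u

theorem region_topAt {p : ℝ × ℝ} (hp : p ∈ A.P) (s s' : Bool) :
    A.region (A.topAt s p) = A.region (A.topAt s' p) := by
  have : A.region (A.topAt false p) = A.region (A.topAt true p) :=
    Quot.sound ⟨p, hp, rfl, rfl⟩
  cases s <;> cases s' <;> first | rfl | exact this | exact this.symm

noncomputable instance : Fintype A.Region :=
  @Fintype.ofFinite _ (inferInstanceAs (Finite (Quot _)))

/-- The half of Euler's formula that is needed: all segments and the bottom, with one identification
per point of `P`. -/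
theorem card_add_one_le : Fintype.card ι + 1 ≤ Fintype.card A.Region + A.P.card := by
  let _ : Fintype (Quot fun u v : Option ι => ∃ p ∈ A.P, u = A.topAt false p ∧
      v = A.topAt true p) := (inferInstance : Fintype A.Region)
  have := card_le_card_quot_add (N := Option ι) (P := A.P) (fun p => A.topAt false p)
    (fun p => A.topAt true p)
    (fun u v => ∃ p ∈ A.P, u = A.topAt false p ∧ v = A.topAt true p)
    (fun u v ⟨p, hp, h1, h2⟩ => ⟨⟨p, hp⟩, h1, h2⟩)
  rw [Fintype.card_option, Fintype.card_coe] at this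
  exact this

/-- The segment just below the `i`-th one, just to the left or the right of `x`. -/
noncomputable def below (s : Bool) (i : ι) (x : ℝ) : Option ι :=
  topOf {j ∈ A.overAt s x | A.key s x j < A.key s x i} (A.key s x)

variable {A}

theorem injOn_filter (s : Bool) (x : ℝ) (q : ι → Prop) [DecidablePred q] :
    Set.InjOn (A.key s x) ({j ∈ A.overAt s x | q j} : Finset ι) :=
  (key_injOn s x).mono (by intro j hj; exact (Finset.mem_filter.1 hj).1)

/-- Over an inner point of a segment, the region below it is the same to the left and the right. -/
theorem region_below_eq (i : ι) {x : ℝ} (h1 : A.a i < x) (h2 : x < A.b i) :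
    A.region (A.below false i x) = A.region (A.below true i x) := by
  classical
  have hlt : ∀ s, ∀ j ∈ A.overAt s x, (A.key s x j < A.key s x i ↔ A.h j x < A.h i x) := by
    intro s j hj
    rw [key_lt, or_iff_left_iff_imp]
    rintro ⟨he, hm⟩
    by_cases hji : i = j
    · subst hji
      cases s <;> exact (lt_irrefl _ hm).elim
    · exact (h_ne hji h1 h2 (le_of_mem_over hj).1 (le_of_mem_over hj).2 he.symm).elim
  -- Either a point of `P` is directly visible downwards from the segment, and then the segments
  -- below it on the two sides are glued at that point; or the first thing below is a segment
  -- passing over `x`, the same on both sides.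
  by_cases hp : ∃ p ∈ A.P, p.1 = x ∧ p.2 < A.h i x ∧
      ¬ ∃ j, A.a j < x ∧ x < A.b j ∧ p.2 < A.h j x ∧ A.h j x < A.h i x
  · obtain ⟨p, hpP, rfl, hpi, hno⟩ := hp
    have : ∀ s, A.below s i p.1 = A.topAt s p := by
      intro s
      rw [below, topAt]
      congr 1
      refine Finset.filter_congr fun j hj => ?_
      rw [hlt s j hj]
      constructor
      · intro hji
        by_contra hcon
        rcases lt_or_mem_of_mem_over hj with hj' | hj'
        · exact hno ⟨j, hj'.1, hj'.2, not_le.1 hcon, hji⟩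
        · have := A.injOn _ hj' _ hpP rfl
          exact hcon (congrArg Prod.snd this).le
      · exact fun h => h.trans_lt hpi
    rw [this, this, A.region_topAt hpP]
  · have hend : ∀ s, ∀ j ∈ A.overAt s x, A.h j x < A.h i x → ∃ k, A.a k < x ∧ x < A.b k ∧
        A.h j x ≤ A.h k x ∧ A.h k x < A.h i x := by
      intro s j hj hji
      rcases lt_or_mem_of_mem_over hj with hj' | hj'
      · exact ⟨j, hj'.1, hj'.2, le_rfl, hji⟩
      · by_contra hcon
        exact hp ⟨_, hj', rfl, hji, fun ⟨k, h1, h2, h3, h4⟩ => hcon ⟨k, h1, h2, h3.le, h4⟩⟩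
    set Q : Finset ι := {j | A.a j < x ∧ x < A.b j ∧ A.h j x < A.h i x} with hQ
    have hmQ : ∀ j, j ∈ Q ↔ A.a j < x ∧ x < A.b j ∧ A.h j x < A.h i x := by simp [hQ]
    rcases Q.eq_empty_or_nonempty with hQe | hQn
    · have : ∀ s, A.below s i x = none := by
        intro s
        rw [below, Finset.filter_false_of_mem, topOf_empty]
        intro j hj hji
        rw [hlt s j hj] at hji
        obtain ⟨k, h1, h2, -, h3⟩ := hend s j hj hji
        have : k ∈ Q := (hmQ k).2 ⟨h1, h2, h3⟩
        simp [hQe] at this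
      rw [this, this]
    · obtain ⟨k, hk, hmax⟩ := Q.exists_max_image (fun j => A.h j x) hQn
      have hk' := (hmQ k).1 hk
      have : ∀ s, A.below s i x = some k := by
        intro s
        have hko : k ∈ A.overAt s x := mem_over_of_lt hk'.1 hk'.2.1
        refine topOf_eq_some (injOn_filter s x _)
          (Finset.mem_filter.2 ⟨hko, (hlt s k hko).2 hk'.2.2⟩) ?_
        intro j hj
        obtain ⟨hj, hji⟩ := Finset.mem_filter.1 hj
        rw [hlt s j hj] at hji
        obtain ⟨l, h1, h2, h3, h4⟩ := hend s j hj hji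
        have hlk := hmax l ((hmQ l).2 ⟨h1, h2, h4⟩)
        by_cases hkj : k = j
        · rw [hkj]
        · refine (key_lt.2 (Or.inl (lt_of_le_of_ne (h3.trans hlk) ?_))).le
          exact (h_ne hkj hk'.1 hk'.2.1 (le_of_mem_over hj).1 (le_of_mem_over hj).2).symm
      rw [this, this]

omit [Fintype ι] in
theorem continuous_h (i : ι) : Continuous (A.h i) := by unfold h; fun_prop

-- Among segments of equal height over `x₀` the slope decides just beside it, which is why it is the
-- second entry of `key`.
omit [Fintype ι] in
theorem eventually_key_lt_right (x₀ : ℝ) (j k : ι) : ∀ᶠ x in 𝓝[>] x₀,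
    (A.key true x j < A.key true x k ↔ A.key true x₀ j < A.key true x₀ k) := by
  have main : ∀ j k, A.key true x₀ j < A.key true x₀ k →
      ∀ᶠ x in 𝓝[>] x₀, A.key true x j < A.key true x k := by
    intro j k hjk
    rw [key_lt] at hjk
    rcases hjk with hjk | ⟨he, hm⟩
    · have := ((continuous_h (A := A) j).continuousAt.eventually_lt
        (continuous_h (A := A) k).continuousAt hjk).filter_mono (nhdsWithin_le_nhds (s := Set.Ioi x₀))
      filter_upwards [this] with x hx
      exact key_lt.2 (Or.inl hx)
    · have hm' : A.m j < A.m k := hm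
      filter_upwards [self_mem_nhdsWithin] with x hx
      have hx' : x₀ < x := hx
      refine key_lt.2 (Or.inl ?_)
      simp only [h] at he ⊢
      nlinarith
  rcases lt_trichotomy (A.key true x₀ j) (A.key true x₀ k) with h' | h' | h'
  · filter_upwards [main j k h'] with x hx
    exact iff_of_true hx h'
  · filter_upwards with x
    have : A.key true x j = A.key true x k := by
      simp only [key, EmbeddingLike.apply_eq_iff_eq, Prod.mk.injEq, if_true, h] at h' ⊢
      obtain ⟨h1, h2⟩ := h'
      rw [h2] at h1 ⊢
      exact ⟨by linarith, rfl⟩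
    rw [this, h']
    exact iff_of_false (lt_irrefl _) (lt_irrefl _)
  · filter_upwards [main k j h'] with x hx
    exact iff_of_false hx.not_gt h'.not_gt

omit [Fintype ι] in
theorem eventually_key_lt_left (x₀ : ℝ) (j k : ι) : ∀ᶠ x in 𝓝[<] x₀,
    (A.key true x j < A.key true x k ↔ A.key false x₀ j < A.key false x₀ k) := by
  have main : ∀ j k, A.key false x₀ j < A.key false x₀ k →
      ∀ᶠ x in 𝓝[<] x₀, A.key true x j < A.key true x k := by
    intro j k hjk
    rw [key_lt] at hjk
    rcases hjk with hjk | ⟨he, hm⟩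
    · have := ((continuous_h (A := A) j).continuousAt.eventually_lt
        (continuous_h (A := A) k).continuousAt hjk).filter_mono (nhdsWithin_le_nhds (s := Set.Iio x₀))
      filter_upwards [this] with x hx
      exact key_lt.2 (Or.inl hx)
    · have hm' : A.m k < A.m j := hm
      filter_upwards [self_mem_nhdsWithin] with x hx
      have hx' : x < x₀ := hx
      refine key_lt.2 (Or.inl ?_)
      simp only [h] at he ⊢
      nlinarith
  rcases lt_trichotomy (A.key false x₀ j) (A.key false x₀ k) with h' | h' | h'
  · filter_upwards [main j k h'] with x hx
    exact iff_of_true hx h'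
  · filter_upwards with x
    have : A.key true x j = A.key true x k := by
      simp only [key, EmbeddingLike.apply_eq_iff_eq, Prod.mk.injEq, if_true, if_false, h,
        Bool.false_eq_true, neg_inj] at h' ⊢
      obtain ⟨h1, h2⟩ := h'
      rw [h2] at h1 ⊢
      exact ⟨by linarith, rfl⟩
    rw [this, h']
    exact iff_of_false (lt_irrefl _) (lt_irrefl _)
  · filter_upwards [main k j h'] with x hx
    exact iff_of_false hx.not_gt h'.not_gt

theorem eventually_over_right (x₀ : ℝ) (j : ι) : ∀ᶠ x in 𝓝[>] x₀,
    (j ∈ A.overAt true x ↔ j ∈ A.overAt true x₀) := by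
  simp only [mem_over, if_true]
  rcases le_or_gt (A.a j) x₀ with ha | ha
  · rcases lt_or_ge x₀ (A.b j) with hb | hb
    · filter_upwards [self_mem_nhdsWithin, nhdsWithin_le_nhds (Iio_mem_nhds hb)] with x hx hx'
      exact iff_of_true ⟨ha.trans (le_of_lt hx), hx'⟩ ⟨ha, hb⟩
    · filter_upwards [self_mem_nhdsWithin] with x hx
      have hx' : x₀ < x := hx
      exact iff_of_false (fun h => by linarith [h.2]) (fun h => by linarith [h.2])
  · filter_upwards [nhdsWithin_le_nhds (Iio_mem_nhds ha)] with x hx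
    exact iff_of_false (fun h => by linarith [h.1, Set.mem_Iio.1 hx]) (fun h => by linarith [h.1])

theorem eventually_over_left (x₀ : ℝ) (j : ι) : ∀ᶠ x in 𝓝[<] x₀,
    (j ∈ A.overAt true x ↔ j ∈ A.overAt false x₀) := by
  simp only [mem_over, if_true, Bool.false_eq_true, if_false]
  rcases lt_or_ge (A.a j) x₀ with ha | ha
  · rcases le_or_gt x₀ (A.b j) with hb | hb
    · filter_upwards [self_mem_nhdsWithin, nhdsWithin_le_nhds (Ioi_mem_nhds ha)] with x hx hx'
      exact iff_of_true ⟨le_of_lt hx', lt_of_lt_of_le hx hb⟩ ⟨ha, hb⟩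
    · filter_upwards [nhdsWithin_le_nhds (Ioi_mem_nhds hb)] with x hx
      have hx' : A.b j < x := hx
      exact iff_of_false (fun h => by linarith [h.2]) (fun h => by linarith [h.2])
  · filter_upwards [self_mem_nhdsWithin] with x hx
    have hx' : x < x₀ := hx
    exact iff_of_false (fun h => by linarith [h.1]) (fun h => by linarith [h.1])

theorem eventually_below_right (i : ι) (x₀ : ℝ) :
    ∀ᶠ x in 𝓝[>] x₀, A.below true i x = A.below true i x₀ := by
  have h1 : ∀ᶠ x in 𝓝[>] x₀, ∀ j k : ι,
      (A.key true x j < A.key true x k ↔ A.key true x₀ j < A.key true x₀ k) := by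
    rw [eventually_all]
    intro j
    rw [eventually_all]
    exact eventually_key_lt_right x₀ j
  have h2 : ∀ᶠ x in 𝓝[>] x₀, ∀ j : ι, (j ∈ A.overAt true x ↔ j ∈ A.overAt true x₀) := by
    rw [eventually_all]
    exact eventually_over_right x₀
  filter_upwards [h1, h2] with x h1 h2
  have hO : A.overAt true x = A.overAt true x₀ := Finset.ext h2
  simp only [below, h1, hO]
  exact (topOf_congr (injOn_filter true x₀ _) fun j _ k _ => (h1 j k).symm).symm

theorem eventually_below_left (i : ι) (x₀ : ℝ) :
    ∀ᶠ x in 𝓝[<] x₀, A.below true i x = A.below false i x₀ := by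
  have h1 : ∀ᶠ x in 𝓝[<] x₀, ∀ j k : ι,
      (A.key true x j < A.key true x k ↔ A.key false x₀ j < A.key false x₀ k) := by
    rw [eventually_all]
    intro j
    rw [eventually_all]
    exact eventually_key_lt_left x₀ j
  have h2 : ∀ᶠ x in 𝓝[<] x₀, ∀ j : ι, (j ∈ A.overAt true x ↔ j ∈ A.overAt false x₀) := by
    rw [eventually_all]
    exact eventually_over_left x₀
  filter_upwards [h1, h2] with x h1 h2
  have hO : A.overAt true x = A.overAt false x₀ := Finset.ext h2
  simp only [below, h1, hO]
  exact (topOf_congr (injOn_filter false x₀ _) fun j _ k _ => (h1 j k).symm).symm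

variable (A) in
/-- The region just below a segment. -/
noncomputable def lower (i : ι) : A.Region := A.region (A.below true i (A.a i))

theorem region_below_true (i : ι) {x : ℝ} (h1 : A.a i ≤ x) (h2 : x < A.b i) :
    A.region (A.below true i x) = A.lower i := by
  -- With the discrete topology, continuity on `[a i, b i)` means locally constant. The left half of
  -- a neighbourhood is matched with the right one by `region_below_eq`.
  let _ : TopologicalSpace A.Region := ⊥
  have : DiscreteTopology A.Region := ⟨rfl⟩
  refine (isPreconnected_Ico (a := A.a i) (b := A.b i)).constant
    (f := fun x => A.region (A.below true i x)) ?_ ⟨h1, h2⟩ ⟨le_rfl, A.lt i⟩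
  intro x₀ hx₀
  refine tendsto_const_nhds.congr' (EventuallyEq.symm ?_)
  have hr := eventually_nhdsWithin_iff.1 (eventually_below_right (A := A) i x₀)
  have hl := eventually_nhdsWithin_iff.1 (eventually_below_left (A := A) i x₀)
  refine eventually_nhdsWithin_iff.2 ?_
  filter_upwards [hr, hl] with x hr hl hx
  rcases lt_trichotomy x x₀ with hlt | rfl | hlt
  · have : A.a i < x₀ := hx.1.trans_lt hlt
    simp only [hl hlt, region_below_eq i this hx₀.2]
  · rfl
  · simp only [hr hlt]

theorem region_below_false (i : ι) : A.region (A.below false i (A.b i)) = A.lower i := by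
  have hl := eventually_below_left (A := A) i (A.b i)
  have h2 : ∀ᶠ x in 𝓝[<] (A.b i), A.a i < x :=
    nhdsWithin_le_nhds (Ioi_mem_nhds (A.lt i))
  obtain ⟨x, hx1, hx2, hx3⟩ := (hl.and (h2.and self_mem_nhdsWithin)).exists
  rw [← hx1, region_below_true i hx2.le hx3]

end SegmentSystem

/-! ### Directed segments and the region on their left. -/

namespace SegmentSystem

variable {ι : Type*} [Fintype ι] {A : SegmentSystem ι}

/-- A segment that is over a point of `P` and goes through it starts or ends there. -/
theorem eq_end_of_mem_overAt {s : Bool} {p : ℝ × ℝ} (hp : p ∈ A.P) {i : ι}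
    (hi : i ∈ A.overAt s p.1) (hh : A.h i p.1 = p.2) : p.1 = if s then A.a i else A.b i := by
  have h1 := A.not_mem p hp i
  rw [mem_over] at hi
  cases s
  · have hi' : A.a i < p.1 ∧ p.1 ≤ A.b i := hi
    rcases hi'.2.eq_or_lt with h | h
    · exact h
    · exact (h1 hi'.1 h hh).elim
  · have hi' : A.a i ≤ p.1 ∧ p.1 < A.b i := hi
    rcases hi'.1.eq_or_lt with h | h
    · exact h.symm
    · exact (h1 h hi'.2 hh).elim

variable (A) in
/-- The segment just below the point `p`. -/
noncomputable def belowAt (p : ℝ × ℝ) : Option ι :=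
  topOf {i ∈ A.overAt true p.1 | A.h i p.1 < p.2} (A.key true p.1)

/-- A segment over `p.1` strictly below `p` cannot end there, as `P` has only one point on that
vertical line. Hence it passes, and both sides see the same segments. -/
theorem belowAt_eq {p : ℝ × ℝ} (hp : p ∈ A.P) (s : Bool) :
    A.belowAt p = topOf {i ∈ A.overAt s p.1 | A.h i p.1 < p.2} (A.key s p.1) := by
  have hmem : ∀ s, ∀ i ∈ A.overAt s p.1, A.h i p.1 < p.2 → A.a i < p.1 ∧ p.1 < A.b i := by
    intro s i hi hlt
    rcases lt_or_mem_of_mem_over hi with h | h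
    · exact h
    · have := A.injOn _ h _ hp rfl
      exact (hlt.ne (congrArg Prod.snd this)).elim
  have hset : {i ∈ A.overAt true p.1 | A.h i p.1 < p.2} =
      {i ∈ A.overAt s p.1 | A.h i p.1 < p.2} := by
    ext i
    simp only [Finset.mem_filter]
    constructor
    · rintro ⟨h1, h2⟩
      exact ⟨mem_over_of_lt (hmem _ i h1 h2).1 (hmem _ i h1 h2).2, h2⟩
    · rintro ⟨h1, h2⟩
      exact ⟨mem_over_of_lt (hmem _ i h1 h2).1 (hmem _ i h1 h2).2, h2⟩
  rw [belowAt, ← hset]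
  refine topOf_congr (injOn_filter true p.1 _) fun j hj k hk => ?_
  obtain ⟨hj1, hj2⟩ := Finset.mem_filter.1 hj
  obtain ⟨hk1, hk2⟩ := Finset.mem_filter.1 hk
  rw [key_lt, key_lt]
  by_cases hjk : j = k
  · subst hjk; cases s <;> simp
  · have := h_ne hjk (hmem _ j hj1 hj2).1 (hmem _ j hj1 hj2).2 (le_of_mem_over hk1).1
      (le_of_mem_over hk1).2
    simp [this]

variable (A) in
/-- The point where a segment, directed to the right (`false`) or to the left (`true`), starts. -/
def src (d : ι × Bool) : ℝ × ℝ :=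
  if d.2 then (A.b d.1, A.h d.1 (A.b d.1)) else (A.a d.1, A.h d.1 (A.a d.1))

variable (A) in
/-- The counterclockwise order of the directed segments with the same source. -/
def dirKey (d : ι × Bool) : Bool ×ₗ ℝ := toLex (d.2, A.m d.1)

variable (A) in
/-- The region to the left of a directed segment. -/
noncomputable def left (d : ι × Bool) : A.Region :=
  if d.2 then A.lower d.1 else A.region (some d.1)

omit [Fintype ι] in
theorem src_mem (d : ι × Bool) : A.src d ∈ A.P := by
  unfold src
  split_ifs
  · exact A.right_mem _
  · exact A.left_mem _

theorem mem_overAt_src (i : ι) (s : Bool) : i ∈ A.overAt s (A.src (i, !s)).1 := by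
  rw [mem_over]
  cases s
  · exact ⟨A.lt i, le_rfl⟩
  · exact ⟨le_rfl, A.lt i⟩

omit [Fintype ι] in
theorem h_src (i : ι) (t : Bool) : A.h i (A.src (i, t)).1 = (A.src (i, t)).2 := by
  cases t <;> rfl

theorem region_below_src (i : ι) (s : Bool) :
    A.region (A.below s i (A.src (i, !s)).1) = A.lower i := by
  cases s
  · exact region_below_false i
  · rfl

theorem src_eq {s : Bool} {p : ℝ × ℝ} (hp : p ∈ A.P) {i : ι} (hi : i ∈ A.overAt s p.1)
    (hh : A.h i p.1 = p.2) : A.src (i, !s) = p := by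
  have h1 := eq_end_of_mem_overAt hp hi hh
  refine A.injOn _ (src_mem _) _ hp ?_
  rw [h1]
  cases s <;> rfl

/-- `topAt` is the segment at the point itself with the largest slope to the right or the smallest
one to the left, if there is one. -/
theorem topAt_src_eq_some (i : ι) (s : Bool) (hmax : ∀ j, A.src (j, !s) = A.src (i, !s) →
    if s then A.m j ≤ A.m i else A.m i ≤ A.m j) : A.topAt s (A.src (i, !s)) = some i := by
  refine topOf_eq_some (injOn_filter s _ _)
    (Finset.mem_filter.2 ⟨mem_overAt_src i s, (h_src i _).le⟩) fun j hj => ?_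
  obtain ⟨hj1, hj2⟩ := Finset.mem_filter.1 hj
  rw [key_le, h_src]
  rcases hj2.lt_or_eq with hlt | heq
  · exact Or.inl hlt
  · exact Or.inr ⟨heq, hmax j (src_eq (src_mem _) hj1 heq)⟩

theorem topAt_eq_belowAt {s : Bool} {p : ℝ × ℝ} (hp : p ∈ A.P)
    (hno : ∀ j, A.src (j, !s) ≠ p) : A.topAt s p = A.belowAt p := by
  rw [belowAt_eq hp s, topAt]
  congr 1
  refine Finset.filter_congr fun j hj => ⟨fun h => lt_of_le_of_ne h fun heq => ?_, le_of_lt⟩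
  exact hno j (src_eq hp hj heq)

theorem below_src_eq_belowAt (i : ι) (s : Bool) (hmin : ∀ j, A.src (j, !s) = A.src (i, !s) →
    if s then A.m i ≤ A.m j else A.m j ≤ A.m i) :
    A.below s i (A.src (i, !s)).1 = A.belowAt (A.src (i, !s)) := by
  rw [belowAt_eq (src_mem _) s, below]
  congr 1
  refine Finset.filter_congr fun j hj => ?_
  rw [key_lt, h_src, or_iff_left_iff_imp]
  rintro ⟨heq, hm⟩
  have := hmin j (src_eq (src_mem _) hj heq)
  cases s
  · exact (not_lt.2 this hm).elim
  · exact (not_lt.2 this hm).elim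

theorem below_src_eq_some (i j : ι) (s : Bool) (hij : A.src (j, !s) = A.src (i, !s))
    (hlt : if s then A.m i < A.m j else A.m j < A.m i)
    (hnext : ∀ k, A.src (k, !s) = A.src (i, !s) → if s then ¬ (A.m i < A.m k ∧ A.m k < A.m j) else
      ¬ (A.m j < A.m k ∧ A.m k < A.m i)) :
    A.below s j (A.src (j, !s)).1 = some i := by
  have hh : A.h j (A.src (i, !s)).1 = (A.src (i, !s)).2 := by rw [← hij, h_src]
  rw [hij]
  refine topOf_eq_some (injOn_filter s _ _) (Finset.mem_filter.2 ⟨mem_overAt_src i s, ?_⟩)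
    fun k hk => ?_
  · rw [key_lt, h_src, hh]
    exact Or.inr ⟨rfl, hlt⟩
  · obtain ⟨hk1, hk2⟩ := Finset.mem_filter.1 hk
    rw [key_lt, hh] at hk2
    rw [key_le, h_src]
    rcases hk2 with hk2 | ⟨hk2, hk3⟩
    · exact Or.inl hk2
    · refine Or.inr ⟨hk2, ?_⟩
      have := hnext k (src_eq (src_mem _) hk1 hk2)
      cases s
      · exact not_lt.1 fun h => this ⟨hk3, h⟩
      · exact not_lt.1 fun h => this ⟨h, hk3⟩

omit [Fintype ι] in
theorem dirKey_lt {i j : ι} {s t : Bool} : A.dirKey (i, s) < A.dirKey (j, t) ↔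
    s < t ∨ s = t ∧ A.m i < A.m j := by
  simp [dirKey, Prod.Lex.toLex_lt_toLex]

omit [Fintype ι] in
theorem dirKey_le {i j : ι} {s t : Bool} : A.dirKey (i, s) ≤ A.dirKey (j, t) ↔
    s < t ∨ s = t ∧ A.m i ≤ A.m j := by
  simp [dirKey, Prod.Lex.toLex_le_toLex]

/-- The region to the left of a directed segment is the one to the right of the next. -/
theorem left_eq_of_isCyclicNext {d e : ι × Bool} (hde : IsCyclicNext A.src A.dirKey d e) :
    A.left d = A.left (e.1, !e.2) := by
  obtain ⟨i, s⟩ := d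
  obtain ⟨j, t⟩ := e
  obtain ⟨hsrc, hcase⟩ := hde
  have htf : ¬ (true < false) := by decide
  rcases hcase with ⟨hlt, hnext⟩ | ⟨hmax, hmin⟩
  · rw [dirKey_lt] at hlt
    simp only [Prod.forall, dirKey_lt] at hnext
    cases s <;> cases t
    · have h1 := below_src_eq_some (A := A) i j true hsrc.symm (by simpa using hlt)
        fun k hk => by simpa using hnext k false hk
      have h2 := region_below_src (A := A) j true
      rw [h1] at h2
      exact h2
    -- Turning from the right to the left over the top of the point: the highest segments on the two
    -- sides are identified there.
    · have h1 := topAt_src_eq_some (A := A) i true fun k hk => by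
        simpa using hnext k false hk
      have h2 := topAt_src_eq_some (A := A) j false fun k hk => by
        simpa using hnext k true (hk.trans hsrc.symm)
      have h3 := A.region_topAt (src_mem (i, false)) true false
      rw [show A.topAt true (A.src (i, false)) = some i from h1, hsrc,
        show A.topAt false (A.src (j, true)) = some j from h2] at h3
      exact h3
    · simp [htf] at hlt
    · have h1 := below_src_eq_some (A := A) j i false hsrc (by simpa using hlt)
        fun k hk => by simpa using hnext k true (hk.trans hsrc.symm)
      have h2 := region_below_src (A := A) i false
      rw [h1] at h2
      exact h2.symm
  · simp only [Prod.forall, dirKey_le] at hmax hmin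
    cases s <;> cases t
    -- Wrapping around with nothing on the left: the left side sees the segment just below the
    -- point, which is also just below the lowest segment on the right.
    · have hno : ∀ k, A.src (k, true) ≠ A.src (i, false) := fun k hk => by
        simpa [htf] using hmax k true hk
      have h1 := topAt_src_eq_some (A := A) i true fun k hk => by
        simpa using hmax k false hk
      have h2 := topAt_eq_belowAt (A := A) (s := false) (src_mem (i, false)) hno
      have h3 := A.region_topAt (src_mem (i, false)) true false
      have h4 := below_src_eq_belowAt (A := A) j true fun k hk => by
        simpa using hmin k false (hk.trans hsrc.symm)
      have h5 := region_below_src (A := A) j true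
      rw [h4] at h5
      rw [show A.topAt true (A.src (i, false)) = some i from h1, h2, hsrc] at h3
      exact h3.trans h5
    · have := hmin i false rfl
      simp [htf] at this
    -- Passing underneath the point: both segments have `belowAt` just below them.
    · have h1 := below_src_eq_belowAt (A := A) i false fun k hk => by
        simpa using hmax k true hk
      have h2 := region_below_src (A := A) i false
      have h3 := below_src_eq_belowAt (A := A) j true fun k hk => by
        simpa using hmin k false (hk.trans hsrc.symm)
      have h4 := region_below_src (A := A) j true
      rw [h1] at h2
      rw [h3] at h4
      have h5 : A.src (i, !false) = A.src (j, !true) := hsrc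
      rw [h5] at h2
      exact h2.symm.trans h4
    · have hno : ∀ k, A.src (k, false) ≠ A.src (i, true) := fun k hk => by
        simpa [htf] using hmin k false hk
      have h1 := topAt_src_eq_some (A := A) j false fun k hk => by
        simpa using hmin k true (hk.trans hsrc.symm)
      have h2 := topAt_eq_belowAt (A := A) (s := true) (src_mem (i, true)) hno
      have h3 := A.region_topAt (src_mem (i, true)) true false
      have h4 := below_src_eq_belowAt (A := A) i false fun k hk => by
        simpa using hmax k true hk
      have h5 := region_below_src (A := A) i false
      rw [h4] at h5
      rw [h2, hsrc, show A.topAt false (A.src (j, true)) = some j from h1] at h3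
      have h6 : A.src (i, !false) = A.src (j, true) := hsrc
      rw [h6] at h5
      exact h5.symm.trans h3

theorem left_surjective [Nonempty ι] : Function.Surjective A.left := by
  intro K
  induction K using Quot.ind with
  | mk u =>
    rcases u with _ | i
    · obtain ⟨i₀⟩ := ‹Nonempty ι›
      -- The bottom region lies below the lowest segment over any covered abscissa.
      have hne : (A.overAt true (A.a i₀)).Nonempty := ⟨i₀, mem_overAt_src i₀ true⟩
      obtain ⟨j, hj, hmin⟩ := Finset.exists_min_image _ (A.key true (A.a i₀)) hne
      refine ⟨(j, true), ?_⟩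
      have hj' : A.a j ≤ A.a i₀ ∧ A.a i₀ < A.b j := mem_over.1 hj
      have h1 := region_below_true j hj'.1 hj'.2
      rw [below, Finset.filter_false_of_mem fun k hk => not_lt.2 (hmin k hk), topOf_empty] at h1
      exact h1.symm
    · exact ⟨(i, false), rfl⟩

end SegmentSystem

/-! ### Cyclic orders and the rotation system of a drawing. -/

section CyclicNext

variable {D X κ : Type*} [LinearOrder κ] {src : D → X} {key : D → κ}

theorem exists_isCyclicNext [Finite D] (d : D) : ∃ e, IsCyclicNext src key d e := by
  by_cases h : ∃ f, src f = src d ∧ key d < key f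
  · obtain ⟨e, ⟨he1, he2⟩, hmin⟩ := Set.exists_min_image {f | src f = src d ∧ key d < key f} key
      (Set.toFinite _) h
    refine ⟨e, he1.symm, Or.inl ⟨he2, fun f hf ⟨h1, h2⟩ => ?_⟩⟩
    exact (hmin f ⟨hf, h1⟩).not_gt h2
  · push Not at h
    obtain ⟨e, he, hmin⟩ := Set.exists_min_image {f | src f = src d} key (Set.toFinite _) ⟨d, rfl⟩
    exact ⟨e, Eq.symm he, Or.inr ⟨h, hmin⟩⟩

theorem IsCyclicNext.left_unique (hinj : ∀ d e, src d = src e → key d = key e → d = e) {d d' e : D}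
    (h : IsCyclicNext src key d e) (h' : IsCyclicNext src key d' e) : d = d' := by
  have hs : src d = src d' := h.1.trans h'.1.symm
  refine hinj d d' hs ?_
  rcases h.2 with ⟨h1, h2⟩ | ⟨h1, h2⟩ <;> rcases h'.2 with ⟨h3, h4⟩ | ⟨h3, h4⟩
  · refine le_antisymm (not_lt.1 fun hlt => ?_) (not_lt.1 fun hlt => ?_)
    · exact h4 d hs ⟨hlt, h1⟩
    · exact h2 d' hs.symm ⟨hlt, h3⟩
  · exact ((h4 d hs).not_gt h1).elim
  · exact ((h2 d' hs.symm).not_gt h3).elim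
  · exact le_antisymm (h3 d hs) (h1 d' hs.symm)

theorem exists_perm_isCyclicNext [Finite D] (hinj : ∀ d e, src d = src e → key d = key e → d = e) :
    ∃ σ : Equiv.Perm D, (∀ d, IsCyclicNext src key d (σ d)) ∧
      ∀ d e, src d = src e → σ.SameCycle d e := by
  choose next hnext using fun d => exists_isCyclicNext (src := src) (key := key) d
  have hi : Function.Injective next := fun d d' h =>
    (hnext d).left_unique hinj (h ▸ hnext d')
  let σ : Equiv.Perm D := Equiv.ofBijective next (Finite.injective_iff_bijective.1 hi)
  have hσ : ∀ d, IsCyclicNext src key d (σ d) := hnext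
  refine ⟨σ, hσ, ?_⟩
  -- Successors climb in `key` until they reach the maximum at the source, so all elements with one
  -- source are in its cycle.
  have hmax : ∀ m, (∀ f, src f = src m → key f ≤ key m) → ∀ d, src d = src m → σ.SameCycle d m := by
    intro m hm d
    have wf : WellFounded fun x y : D => key y < key x :=
      Finite.wellFounded_of_trans_of_irrefl _
    induction d using wf.induction with
    | _ d ih =>
      intro hd
      rcases (hσ d).2 with ⟨h1, -⟩ | ⟨h1, -⟩
      · have := ih (σ d) h1 ((hσ d).1.symm.trans hd)
        exact Equiv.Perm.sameCycle_apply_left.1 this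
      · have : d = m := hinj d m hd (le_antisymm (hm d hd) (h1 m hd.symm))
        rw [this]
  intro d e hde
  obtain ⟨m, hm, hm'⟩ := Set.exists_max_image {f | src f = src d} key (Set.toFinite _) ⟨d, rfl⟩
  have hm1 : src m = src d := hm
  have h1 := hmax m (fun f hf => hm' f (hf.trans hm1)) d hm1.symm
  have h2 := hmax m (fun f hf => hm' f (hf.trans hm1)) e (hde.symm.trans hm1.symm)
  exact h1.trans h2.symm

theorem isCyclicNext_of_pair {d e : D} (hsrc : src d = src e)
    (h : ∀ f, src f = src d → f = d ∨ f = e) : IsCyclicNext src key d e := by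
  refine ⟨hsrc, ?_⟩
  rcases lt_or_ge (key d) (key e) with hlt | hle
  · refine Or.inl ⟨hlt, fun f hf ⟨h1, h2⟩ => ?_⟩
    rcases h f hf with rfl | rfl
    · exact lt_irrefl _ h1
    · exact lt_irrefl _ h2
  · refine Or.inr ⟨fun f hf => ?_, fun f hf => ?_⟩ <;> rcases h f hf with rfl | rfl
    · exact le_rfl
    · exact hle
    · exact hle
    · exact le_rfl

end CyclicNext

/-- The cyclic order at a source carries over to a system of representatives of the directed
segments. -/
theorem IsCyclicNext.map {D D' X X' κ : Type*} [LinearOrder κ] {src : D → X} {src' : D' → X'}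
    {key' : D' → κ} (F : D → D') (hF : ∀ d e, src d = src e → src' (F d) = src' (F e))
    (hF' : ∀ d f, src' f = src' (F d) → ∃ e, src e = src d ∧ F e = f) {d e : D}
    (h : IsCyclicNext src (fun d => key' (F d)) d e) : IsCyclicNext src' key' (F d) (F e) := by
  refine ⟨hF _ _ h.1, ?_⟩
  rcases h.2 with ⟨h1, h2⟩ | ⟨h1, h2⟩
  · refine Or.inl ⟨h1, fun f hf => ?_⟩
    obtain ⟨e', he', rfl⟩ := hF' d f hf
    exact h2 e' he'
  · refine Or.inr ⟨fun f hf => ?_, fun f hf => ?_⟩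
    · obtain ⟨e', he', rfl⟩ := hF' d f hf
      exact h1 e' he'
    · obtain ⟨e', he', rfl⟩ := hF' d f hf
      exact h2 e' he'

theorem SimpleGraph.exists_rotationSystem {V κ : Type*} [Finite V] [LinearOrder κ]
    (G : SimpleGraph V) (key : G.Dart → κ)
    (hinj : ∀ d e : G.Dart, d.fst = e.fst → key d = key e → d = e) :
    ∃ R : G.RotationSystem, ∀ d, IsCyclicNext (fun d : G.Dart => d.fst) key (R.next d) d := by
  have : Finite G.Dart := Finite.of_injective (fun d : G.Dart => d.toProd) Dart.toProd_injective
  obtain ⟨σ, h1, h2⟩ := exists_perm_isCyclicNext (src := fun d : G.Dart => d.fst) (key := key) hinj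
  -- The inverse, that is, the clockwise order, makes `face` keep its region on the left.
  refine ⟨⟨σ.symm, fun d => ?_, fun d d' h => ?_⟩, fun d => ?_⟩
  · have := (h1 (σ.symm d)).1
    rwa [Equiv.apply_symm_apply] at this
  · exact Equiv.Perm.sameCycle_inv.2 (h2 d d' h)
  · have := h1 (σ.symm d)
    rwa [Equiv.apply_symm_apply] at this

namespace SegmentSystem

theorem dirKey_injective {ι : Type*} [Fintype ι] {A : SegmentSystem ι} {d e : ι × Bool}
    (h : A.src d = A.src e) (hk : A.dirKey d = A.dirKey e) : d = e := by
  obtain ⟨i, s⟩ := d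
  obtain ⟨j, t⟩ := e
  simp only [dirKey, EmbeddingLike.apply_eq_iff_eq, Prod.mk.injEq] at hk
  obtain ⟨rfl, hm⟩ := hk
  have h1 := mem_overAt_src (A := A) i (!s)
  have h2 := mem_overAt_src (A := A) j (!s)
  rw [Bool.not_not] at h1 h2
  rw [← h] at h2
  have h3 : A.h j (A.src (i, s)).1 = (A.src (i, s)).2 := by rw [h, h_src]
  have := key_injOn (A := A) (!s) _ h1 h2 (by simp only [key, h_src, h3, hm])
  rw [this]

end SegmentSystem

/-! ### Polygonal drawings and Euler's inequality. -/

namespace SimpleGraph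

/-- A plane drawing whose edges are polygons with given corners, no two of which lie on a vertical
line. -/
structure PolygonDrawing {V : Type u} (G : SimpleGraph V) where
  dart : G.edgeSet → G.Dart
  edge_dart : ∀ e, (dart e).edge = e
  n : G.edgeSet → ℕ
  pos : V → ℝ × ℝ
  q : G.edgeSet → ℕ → ℝ × ℝ
  q_zero : ∀ e, q e 0 = pos (dart e).fst
  q_n : ∀ e, q e (n e) = pos (dart e).snd
  pos_injective : Function.Injective pos
  q_injOn : ∀ e, Set.InjOn (q e) (Set.Iic (n e))
  same : ∀ e i j x, i < j → j < n e → x ∈ segment ℝ (q e i) (q e (i + 1)) →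
    x ∈ segment ℝ (q e j) (q e (j + 1)) → j = i + 1 ∧ x = q e j
  pos_mem : ∀ e i v, i < n e → pos v ∈ segment ℝ (q e i) (q e (i + 1)) →
    v = (dart e).fst ∨ v = (dart e).snd
  ne : ∀ e e' i j x, e ≠ e' → i < n e → j < n e' → x ∈ segment ℝ (q e i) (q e (i + 1)) →
    x ∈ segment ℝ (q e' j) (q e' (j + 1)) → ∃ v, x = pos v
  fst_inj : ∀ e e' i j, i ≤ n e → j ≤ n e' → (q e i).1 = (q e' j).1 → q e i = q e' j

namespace PolygonDrawing

variable {V : Type u} {G : SimpleGraph V} (D : G.PolygonDrawing)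

theorem n_pos (e : G.edgeSet) : 0 < D.n e := by
  rcases Nat.eq_zero_or_pos (D.n e) with h | h
  · have h1 := D.q_n e
    rw [h, D.q_zero] at h1
    exact ((D.dart e).adj.ne (D.pos_injective h1)).elim
  · exact h

variable {D}

theorem eq_dart_or_eq_symm (d : G.Dart) :
    d = D.dart ⟨d.edge, d.edge_mem⟩ ∨ d = (D.dart ⟨d.edge, d.edge_mem⟩).symm := by
  rw [← dart_edge_eq_iff, D.edge_dart]

theorem corner_eq_of_mem {e : G.edgeSet} {i k : ℕ} (hi : i < D.n e) (hk : k ≤ D.n e)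
    (h : D.q e k ∈ segment ℝ (D.q e i) (D.q e (i + 1))) : k = i ∨ k = i + 1 := by
  rcases lt_trichotomy k i with hlt | heq | hlt
  · obtain ⟨-, h2⟩ := D.same e k i _ hlt hi (left_mem_segment ℝ _ _) h
    exact absurd (D.q_injOn e (Set.mem_Iic.2 hk) (Set.mem_Iic.2 hi.le) h2) hlt.ne
  · exact Or.inl heq
  · obtain ⟨k, rfl⟩ : ∃ l, k = l + 1 := ⟨k - 1, by omega⟩
    rcases (Nat.lt_succ_iff.1 hlt).lt_or_eq with h'' | h''
    · obtain ⟨h1, h2⟩ := D.same e i k _ h'' (by omega) h (right_mem_segment ℝ _ _)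
      have := D.q_injOn e (Set.mem_Iic.2 hk) (Set.mem_Iic.2 (by omega)) h2
      omega
    · exact Or.inr (by rw [h''])

theorem eq_corner_of_pos_mem {e : G.edgeSet} {i : ℕ} {v : V} (hi : i < D.n e)
    (h : D.pos v ∈ segment ℝ (D.q e i) (D.q e (i + 1))) :
    v = (D.dart e).fst ∧ i = 0 ∨ v = (D.dart e).snd ∧ i + 1 = D.n e := by
  rcases D.pos_mem e i v hi h with rfl | rfl
  · rw [← D.q_zero] at h
    have := corner_eq_of_mem hi (Nat.zero_le _) h
    exact Or.inl ⟨rfl, by omega⟩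
  · rw [← D.q_n] at h
    have := corner_eq_of_mem hi le_rfl h
    exact Or.inr ⟨rfl, by omega⟩

theorem eq_end_of_pos_mem {e : G.edgeSet} {i : ℕ} {v : V} (hi : i < D.n e)
    (h : D.pos v ∈ segment ℝ (D.q e i) (D.q e (i + 1))) :
    D.pos v = D.q e i ∨ D.pos v = D.q e (i + 1) := by
  rcases eq_corner_of_pos_mem hi h with ⟨rfl, rfl⟩ | ⟨rfl, hi'⟩
  · exact Or.inl (D.q_zero e).symm
  · rw [hi']
    exact Or.inr (D.q_n e).symm

theorem eq_end_of_mem {e e' : G.edgeSet} {i j : ℕ} {x : ℝ × ℝ} (hne : e = e' → i ≠ j)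
    (hi : i < D.n e) (hj : j < D.n e') (h : x ∈ segment ℝ (D.q e i) (D.q e (i + 1)))
    (h' : x ∈ segment ℝ (D.q e' j) (D.q e' (j + 1))) : x = D.q e i ∨ x = D.q e (i + 1) := by
  by_cases he : e = e'
  · subst he
    rcases lt_or_gt_of_ne (hne rfl) with hlt | hlt
    · obtain ⟨rfl, h2⟩ := D.same e i j x hlt hj h h'
      exact Or.inr h2
    · exact Or.inl (D.same e j i x hlt hi h' h).2
  · obtain ⟨v, rfl⟩ := D.ne e e' i j x he hi hj h h'
    exact eq_end_of_pos_mem hi h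

theorem corner_mem {e : G.edgeSet} {k : ℕ} (hk : k ≤ D.n e) : ∃ j < D.n e,
    D.q e k ∈ segment ℝ (D.q e j) (D.q e (j + 1)) := by
  rcases hk.lt_or_eq with h | h
  · exact ⟨k, h, left_mem_segment ℝ _ _⟩
  · have := D.n_pos e
    refine ⟨k - 1, by omega, ?_⟩
    have : k - 1 + 1 = k := by omega
    rw [this]
    exact right_mem_segment ℝ _ _

theorem corner_eq_end_of_mem {e e' : G.edgeSet} {i k : ℕ} (hi : i < D.n e) (hk : k ≤ D.n e')
    (h : D.q e' k ∈ segment ℝ (D.q e i) (D.q e (i + 1))) :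
    D.q e' k = D.q e i ∨ D.q e' k = D.q e (i + 1) := by
  by_cases he : e = e'
  · subst he
    rcases corner_eq_of_mem hi hk h with rfl | rfl
    · exact Or.inl rfl
    · exact Or.inr rfl
  · obtain ⟨j, hj, hj'⟩ := corner_mem hk
    exact eq_end_of_mem (fun h => (he h).elim) hi hj h hj'

/-- An inner corner of an edge belongs to no other edge. -/
theorem inner_corner {e e' : G.edgeSet} {i k : ℕ} (hi : 0 < i) (hi' : i < D.n e) (hk : k ≤ D.n e')
    (h : D.q e i = D.q e' k) : e = e' ∧ i = k := by
  by_cases he : e = e'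
  · subst he
    exact ⟨rfl, D.q_injOn e (Set.mem_Iic.2 hi'.le) (Set.mem_Iic.2 hk) h⟩
  · obtain ⟨j, hj, hj'⟩ := corner_mem hk
    obtain ⟨v, hv⟩ := D.ne e e' i j _ he hi' hj (left_mem_segment ℝ _ _) (h ▸ hj')
    have h1 : D.pos v ∈ segment ℝ (D.q e i) (D.q e (i + 1)) := by
      rw [← hv]
      exact left_mem_segment ℝ _ _
    rcases eq_corner_of_pos_mem hi' h1 with ⟨-, h2⟩ | ⟨rfl, h2⟩
    · omega
    · rw [← D.q_n] at hv
      have := D.q_injOn e (Set.mem_Iic.2 hi'.le) (Set.mem_Iic.2 le_rfl) hv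
      omega

theorem fst_ne {e : G.edgeSet} {i : ℕ} (hi : i < D.n e) : (D.q e i).1 ≠ (D.q e (i + 1)).1 := fun h => by
  have h1 := D.fst_inj e e i (i + 1) hi.le hi h
  have := D.q_injOn e (Set.mem_Iic.2 hi.le) (Set.mem_Iic.2 hi) h1
  omega

variable (D)

/-- The slope of a segment. -/
noncomputable def slope (s : Σ e : G.edgeSet, Fin (D.n e)) : ℝ :=
  ((D.q s.1 (s.2 + 1)).2 - (D.q s.1 s.2).2) / ((D.q s.1 (s.2 + 1)).1 - (D.q s.1 s.2).1)

/-- The height of the line through a segment over zero. -/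
noncomputable def offset (s : Σ e : G.edgeSet, Fin (D.n e)) : ℝ :=
  (D.q s.1 s.2).2 - D.slope s * (D.q s.1 s.2).1

theorem line_left (s : Σ e : G.edgeSet, Fin (D.n e)) :
    D.offset s + D.slope s * (D.q s.1 s.2).1 = (D.q s.1 s.2).2 := by
  simp [offset]

theorem line_right (s : Σ e : G.edgeSet, Fin (D.n e)) :
    D.offset s + D.slope s * (D.q s.1 (s.2 + 1)).1 = (D.q s.1 (s.2 + 1)).2 := by
  have h := sub_ne_zero.2 (fst_ne (D := D) s.2.2).symm
  have : D.slope s * ((D.q s.1 (s.2 + 1)).1 - (D.q s.1 s.2).1) =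
      (D.q s.1 (s.2 + 1)).2 - (D.q s.1 s.2).2 := div_mul_cancel₀ _ h
  simp only [offset]
  linarith

theorem mem_segment (s : Σ e : G.edgeSet, Fin (D.n e)) {x : ℝ}
    (h1 : min (D.q s.1 s.2).1 (D.q s.1 (s.2 + 1)).1 ≤ x)
    (h2 : x ≤ max (D.q s.1 s.2).1 (D.q s.1 (s.2 + 1)).1) :
    (x, D.offset s + D.slope s * x) ∈ segment ℝ (D.q s.1 s.2) (D.q s.1 (s.2 + 1)) := by
  have hx : x ∈ segment ℝ (D.q s.1 s.2).1 (D.q s.1 (s.2 + 1)).1 := by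
    rw [segment_eq_uIcc]
    exact ⟨h1, h2⟩
  obtain ⟨a, b, ha, hb, hab, rfl⟩ := hx
  refine ⟨a, b, ha, hb, hab, ?_⟩
  have e1 := D.line_left s
  have e2 := D.line_right s
  refine Prod.ext rfl ?_
  simp only [Prod.snd_add, Prod.smul_snd, smul_eq_mul]
  rw [← e1, ← e2]
  have : b = 1 - a := by linarith
  rw [this]
  ring

/-- A segment, directed along its edge (`true`) or in the opposite direction (`false`). -/
noncomputable def directed (s : Σ e : G.edgeSet, Fin (D.n e)) (t : Bool) :
    (Σ e : G.edgeSet, Fin (D.n e)) × Bool :=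
  open Classical in
  (s, if (D.q s.1 (s.2 + 1)).1 < (D.q s.1 s.2).1 then t else !t)

theorem directed_not (s : Σ e : G.edgeSet, Fin (D.n e)) (t : Bool) :
    ((D.directed s t).1, !(D.directed s t).2) = D.directed s (!t) := by
  simp only [directed]
  split_ifs <;> rfl

theorem exists_directed (f : (Σ e : G.edgeSet, Fin (D.n e)) × Bool) :
    ∃ s t, D.directed s t = f := by
  obtain ⟨s, t⟩ := f
  by_cases h : (D.q s.1 (s.2 + 1)).1 < (D.q s.1 s.2).1
  · exact ⟨s, t, by rw [directed, if_pos h]⟩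
  · exact ⟨s, !t, by rw [directed, if_neg h, Bool.not_not]⟩

theorem directed_injective {s s' : Σ e : G.edgeSet, Fin (D.n e)} {t t' : Bool}
    (h : D.directed s t = D.directed s' t') : s = s' ∧ t = t' := by
  obtain ⟨h1, h2⟩ := Prod.mk.inj h
  subst h1
  refine ⟨rfl, ?_⟩
  split_ifs at h2
  · exact h2
  · exact Bool.not_inj h2

/-- The first segment of the dart `d` of the edge `e`. -/
noncomputable def firstOf (e : G.edgeSet) (d : G.Dart) : (Σ e : G.edgeSet, Fin (D.n e)) × Bool :=
  open Classical in
  if d = D.dart e then D.directed ⟨e, ⟨0, D.n_pos _⟩⟩ true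
  else D.directed ⟨e, ⟨D.n e - 1, Nat.sub_lt (D.n_pos _) one_pos⟩⟩ false

/-- The first segment of a dart. -/
noncomputable def first (d : G.Dart) : (Σ e : G.edgeSet, Fin (D.n e)) × Bool :=
  D.firstOf ⟨d.edge, d.edge_mem⟩ d

theorem first_dart (e : G.edgeSet) : D.first (D.dart e) = D.directed ⟨e, ⟨0, D.n_pos e⟩⟩ true := by
  have h : (⟨(D.dart e).edge, (D.dart e).edge_mem⟩ : G.edgeSet) = e := Subtype.ext (D.edge_dart e)
  rw [first, h, firstOf, if_pos rfl]

theorem first_dart_symm (e : G.edgeSet) : D.first (D.dart e).symm =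
    D.directed ⟨e, ⟨D.n e - 1, Nat.sub_lt (D.n_pos _) one_pos⟩⟩ false := by
  have h : (⟨(D.dart e).symm.edge, (D.dart e).symm.edge_mem⟩ : G.edgeSet) = e :=
    Subtype.ext ((Dart.edge_symm _).trans (D.edge_dart e))
  rw [first, h, firstOf, if_neg (Dart.symm_ne _)]

theorem exists_eq_dart_or (d : G.Dart) : ∃ e, d = D.dart e ∨ d = (D.dart e).symm :=
  ⟨_, eq_dart_or_eq_symm d⟩

variable [Fintype V] [DecidableRel G.Adj]

open Classical in
/-- The segments of a polygonal drawing. -/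
noncomputable def segments : SegmentSystem (Σ e : G.edgeSet, Fin (D.n e)) where
  a s := min (D.q s.1 s.2).1 (D.q s.1 (s.2 + 1)).1
  b s := max (D.q s.1 s.2).1 (D.q s.1 (s.2 + 1)).1
  c := D.offset
  m := D.slope
  P := (Finset.univ : Finset (Σ e : G.edgeSet, Fin (D.n e + 1))).image fun s => D.q s.1 s.2
  lt s := min_lt_max.2 (fst_ne s.2.2)
  cross := by
    rintro ⟨e, i⟩ ⟨e', j⟩ x hne h1 h2 h3 h4 heq
    have m1 := D.mem_segment ⟨e, i⟩ h1 h2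
    have m2 := D.mem_segment ⟨e', j⟩ h3 h4
    rw [← heq] at m2
    have := eq_end_of_mem (D := D) (i := i) (j := j) (by
      rintro rfl hij
      exact hne (by rw [Fin.ext hij])) i.2 j.2 m1 m2
    rcases this with h | h
    · have hx : x = (D.q e i).1 := congrArg Prod.fst h
      simp only [hx]
      rcases le_total (D.q e i).1 (D.q e (i + 1)).1 with hle | hle
      · exact Or.inl (min_eq_left hle).symm
      · exact Or.inr (max_eq_left hle).symm
    · have hx : x = (D.q e (i + 1)).1 := congrArg Prod.fst h
      simp only [hx]
      rcases le_total (D.q e i).1 (D.q e (i + 1)).1 with hle | hle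
      · exact Or.inr (max_eq_right hle).symm
      · exact Or.inl (min_eq_right hle).symm
  left_mem := by
    rintro ⟨e, i⟩
    simp only [Finset.mem_image, Finset.mem_univ, true_and]
    have e1 := D.line_left ⟨e, i⟩
    have e2 := D.line_right ⟨e, i⟩
    simp only at e1 e2
    rcases le_total (D.q e i).1 (D.q e (i + 1)).1 with hle | hle
    · exact ⟨⟨e, i.castSucc⟩, by rw [min_eq_left hle, e1]; rfl⟩
    · exact ⟨⟨e, i.succ⟩, by rw [min_eq_right hle, e2]; simp⟩
  right_mem := by
    rintro ⟨e, i⟩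
    simp only [Finset.mem_image, Finset.mem_univ, true_and]
    have e1 := D.line_left ⟨e, i⟩
    have e2 := D.line_right ⟨e, i⟩
    simp only at e1 e2
    rcases le_total (D.q e i).1 (D.q e (i + 1)).1 with hle | hle
    · exact ⟨⟨e, i.succ⟩, by rw [max_eq_right hle, e2]; simp⟩
    · exact ⟨⟨e, i.castSucc⟩, by rw [max_eq_left hle, e1]; rfl⟩
  injOn := by
    intro p hp r hr hpr
    obtain ⟨⟨e, i⟩, -, rfl⟩ := Finset.mem_image.1 hp
    obtain ⟨⟨e', j⟩, -, rfl⟩ := Finset.mem_image.1 hr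
    exact D.fst_inj e e' i j (Nat.lt_succ_iff.1 i.2) (Nat.lt_succ_iff.1 j.2) hpr
  not_mem := by
    rintro p hp ⟨e, i⟩ h1 h2 heq
    obtain ⟨⟨e', k⟩, -, rfl⟩ := Finset.mem_image.1 hp
    have m := D.mem_segment ⟨e, i⟩ h1.le h2.le
    rw [heq] at m
    have h := corner_eq_end_of_mem (D := D) i.2 (Nat.lt_succ_iff.1 k.2) m
    simp only at h1 h2
    rcases h with h | h <;> rw [h] at h1 h2
    · rcases le_total (D.q e i).1 (D.q e (i + 1)).1 with hle | hle
      · rw [min_eq_left hle] at h1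
        exact lt_irrefl _ h1
      · rw [max_eq_left hle] at h2
        exact lt_irrefl _ h2
    · rcases le_total (D.q e i).1 (D.q e (i + 1)).1 with hle | hle
      · rw [max_eq_right hle] at h2
        exact lt_irrefl _ h2
      · rw [min_eq_right hle] at h1
        exact lt_irrefl _ h1

/-- Every corner is a vertex or one of the `n e - 1` inner corners of an edge, so subdividing edges
does not spoil the count. -/
theorem card_P_le : D.segments.P.card + G.edgeFinset.card ≤
    Fintype.card V + Fintype.card (Σ e : G.edgeSet, Fin (D.n e)) := by
  classical
  have h1 : D.segments.P ⊆ (Finset.univ : Finset V).image D.pos ∪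
      (Finset.univ : Finset (Σ e : G.edgeSet, Fin (D.n e - 1))).image fun s => D.q s.1 (s.2 + 1) := by
    intro p hp
    obtain ⟨⟨e, ⟨k, hk⟩⟩, -, rfl⟩ := Finset.mem_image.1 hp
    rw [Finset.mem_union, Finset.mem_image, Finset.mem_image]
    simp only
    rcases Nat.eq_zero_or_pos k with rfl | h0
    · exact Or.inl ⟨_, Finset.mem_univ _, (D.q_zero e).symm⟩
    · by_cases hn : k = D.n e
      · exact Or.inl ⟨_, Finset.mem_univ _, by rw [hn, D.q_n]⟩
      · refine Or.inr ⟨⟨e, ⟨k - 1, by omega⟩⟩, Finset.mem_univ _, ?_⟩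
        have : k - 1 + 1 = k := by omega
        simp only [this]
  have h2 := (Finset.card_le_card h1).trans (Finset.card_union_le _ _)
  have h3 : ((Finset.univ : Finset V).image D.pos).card ≤ Fintype.card V := Finset.card_image_le
  have h4 : ((Finset.univ : Finset (Σ e : G.edgeSet, Fin (D.n e - 1))).image
      fun s => D.q s.1 (s.2 + 1)).card ≤ ∑ e : G.edgeSet, (D.n e - 1) := by
    refine Finset.card_image_le.trans ?_
    rw [Finset.card_univ, Fintype.card_sigma]
    simp
  have h5 : Fintype.card (Σ e : G.edgeSet, Fin (D.n e)) =
      ∑ e : G.edgeSet, (D.n e - 1) + G.edgeFinset.card := by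
    rw [Fintype.card_sigma, edgeFinset_card, Fintype.card_eq_sum_ones, ← Finset.sum_add_distrib]
    refine Finset.sum_congr rfl fun e _ => ?_
    have := D.n_pos e
    rw [Fintype.card_fin]
    omega
  omega

theorem src_directed (s : Σ e : G.edgeSet, Fin (D.n e)) (t : Bool) :
    D.segments.src (D.directed s t) = if t then D.q s.1 s.2 else D.q s.1 (s.2 + 1) := by
  obtain ⟨e, i⟩ := s
  have hne := fst_ne (D := D) i.2
  have e1 := D.line_left ⟨e, i⟩
  have e2 := D.line_right ⟨e, i⟩
  simp only at e1 e2
  by_cases h : (D.q e (i + 1)).1 < (D.q e i).1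
  · cases t
    · simp only [directed, if_pos h, SegmentSystem.src, SegmentSystem.h, segments,
        Bool.false_eq_true, if_false, min_eq_right h.le, e2]
    · simp only [directed, if_pos h, SegmentSystem.src, SegmentSystem.h, segments, if_true,
        max_eq_left h.le, e1]
  · have h' := not_lt.1 h
    cases t
    · simp only [directed, if_neg h, SegmentSystem.src, SegmentSystem.h, segments,
        Bool.false_eq_true, if_false, Bool.not_false, if_true, max_eq_right h', e2]
    · simp only [directed, if_neg h, SegmentSystem.src, SegmentSystem.h, segments,
        Bool.false_eq_true, if_false, Bool.not_true, if_true, min_eq_left h', e1]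

theorem src_first (d : G.Dart) : D.segments.src (D.first d) = D.pos d.fst := by
  obtain ⟨e, rfl | rfl⟩ := D.exists_eq_dart_or d
  · rw [first_dart, src_directed]
    exact D.q_zero e
  · rw [first_dart_symm, src_directed]
    have := D.n_pos e
    have h : D.n e - 1 + 1 = D.n e := by omega
    simp only [Bool.false_eq_true, if_false, h]
    exact D.q_n e

omit [Fintype V] [DecidableRel G.Adj] in
theorem first_injective : Function.Injective D.first := by
  intro d d' h
  obtain ⟨e, rfl | rfl⟩ := D.exists_eq_dart_or d <;>
    obtain ⟨e', rfl | rfl⟩ := D.exists_eq_dart_or d' <;>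
    simp only [first_dart, first_dart_symm] at h <;>
    obtain ⟨h1, h2⟩ := D.directed_injective h <;>
    obtain ⟨rfl, -⟩ := Sigma.mk.inj h1
  · rfl
  · exact absurd h2 (by decide)
  · exact absurd h2 (by decide)
  · rfl

theorem exists_first_eq {v : V} {f : (Σ e : G.edgeSet, Fin (D.n e)) × Bool}
    (hf : D.segments.src f = D.pos v) : ∃ d : G.Dart, d.fst = v ∧ D.first d = f := by
  obtain ⟨⟨e, i⟩, t, rfl⟩ := D.exists_directed f
  rw [src_directed] at hf
  have hn := D.n_pos e
  cases t
  · simp only [Bool.false_eq_true, if_false] at hf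
    have h1 : D.pos v ∈ segment ℝ (D.q e i) (D.q e (i + 1)) := by
      rw [← hf]
      exact right_mem_segment ℝ _ _
    rcases eq_corner_of_pos_mem i.2 h1 with ⟨rfl, h2⟩ | ⟨rfl, h2⟩
    · rw [← D.q_zero] at hf
      have := D.q_injOn e (Set.mem_Iic.2 i.2) (Set.mem_Iic.2 (Nat.zero_le _)) hf
      omega
    · refine ⟨(D.dart e).symm, rfl, ?_⟩
      rw [first_dart_symm]
      congr 2
      exact Fin.ext (by simp only; omega)
  · simp only [if_true] at hf
    have h1 : D.pos v ∈ segment ℝ (D.q e i) (D.q e (i + 1)) := by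
      rw [← hf]
      exact left_mem_segment ℝ _ _
    rcases eq_corner_of_pos_mem i.2 h1 with ⟨rfl, h2⟩ | ⟨rfl, h2⟩
    · refine ⟨D.dart e, rfl, ?_⟩
      rw [first_dart]
      congr 2
      exact Fin.ext h2.symm
    · rw [← D.q_n] at hf
      have := D.q_injOn e (Set.mem_Iic.2 i.2.le) (Set.mem_Iic.2 le_rfl) hf
      omega

/-- Only two directed segments start at an inner corner, so each is the cyclic successor of the
other, and the region on a side of the edge carries over. -/
theorem left_directed_succ (e : G.edgeSet) (i : ℕ) (hi : i + 1 < D.n e) (t : Bool) :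
    D.segments.left (D.directed ⟨e, ⟨i + 1, hi⟩⟩ t) =
      D.segments.left (D.directed ⟨e, ⟨i, by omega⟩⟩ t) := by
  have s1 : D.segments.src (D.directed ⟨e, ⟨i + 1, hi⟩⟩ true) = D.q e (i + 1) := by
    rw [src_directed, if_pos rfl]
  have s2 : D.segments.src (D.directed ⟨e, ⟨i, by omega⟩⟩ false) = D.q e (i + 1) := by
    rw [src_directed, if_neg (by decide)]
  have hf : ∀ f, D.segments.src f = D.q e (i + 1) →
      f = D.directed ⟨e, ⟨i + 1, hi⟩⟩ true ∨ f = D.directed ⟨e, ⟨i, by omega⟩⟩ false := by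
    intro f hf
    obtain ⟨⟨e', j⟩, s, rfl⟩ := D.exists_directed f
    rw [src_directed] at hf
    cases s
    · simp only [Bool.false_eq_true, if_false] at hf
      obtain ⟨rfl, h⟩ := inner_corner (Nat.succ_pos i) hi j.2 hf.symm
      refine Or.inr ?_
      congr 2
      exact Fin.ext (by simp only; omega)
    · simp only [if_true] at hf
      obtain ⟨rfl, h⟩ := inner_corner (Nat.succ_pos i) hi j.2.le hf.symm
      refine Or.inl ?_
      congr 2
      exact Fin.ext h.symm
  cases t
  · have := SegmentSystem.left_eq_of_isCyclicNext (isCyclicNext_of_pair (key := D.segments.dirKey)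
      (s2.trans s1.symm) fun f h => (hf f (h.trans s2)).symm)
    rw [directed_not] at this
    exact this.symm
  · have := SegmentSystem.left_eq_of_isCyclicNext (isCyclicNext_of_pair (key := D.segments.dirKey)
      (s1.trans s2.symm) fun f h => hf f (h.trans s1))
    rw [directed_not] at this
    exact this

theorem left_directed_eq (e : G.edgeSet) (i j : Fin (D.n e)) (t : Bool) :
    D.segments.left (D.directed ⟨e, i⟩ t) = D.segments.left (D.directed ⟨e, j⟩ t) := by
  have : ∀ (k : ℕ) (hk : k < D.n e), D.segments.left (D.directed ⟨e, ⟨k, hk⟩⟩ t) =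
      D.segments.left (D.directed ⟨e, ⟨0, D.n_pos e⟩⟩ t) := by
    intro k
    induction k with
    | zero => intro _; rfl
    | succ k ih => intro hk; rw [left_directed_succ, ih]
  exact (this i i.2).trans (this j j.2).symm

/-- The first and the last segment of a dart have the same region to their left. -/
theorem left_first_symm (d : G.Dart) : D.segments.left ((D.first d.symm).1, !(D.first d.symm).2) =
    D.segments.left (D.first d) := by
  obtain ⟨e, rfl | rfl⟩ := D.exists_eq_dart_or d
  · rw [first_dart_symm, directed_not, first_dart]
    exact D.left_directed_eq e _ _ _
  · rw [Dart.symm_symm, first_dart_symm, first_dart, directed_not]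
    exact D.left_directed_eq e _ _ _

theorem left_first_surjective [Nonempty G.edgeSet] :
    Function.Surjective fun d => D.segments.left (D.first d) := by
  have : Nonempty (Σ e : G.edgeSet, Fin (D.n e)) := by
    obtain ⟨e⟩ := ‹Nonempty G.edgeSet›
    exact ⟨⟨e, ⟨0, D.n_pos e⟩⟩⟩
  intro K
  obtain ⟨f, rfl⟩ := SegmentSystem.left_surjective (A := D.segments) K
  obtain ⟨⟨e, i⟩, t, rfl⟩ := D.exists_directed f
  cases t
  · refine ⟨(D.dart e).symm, ?_⟩
    simp only [first_dart_symm]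
    exact D.left_directed_eq e _ _ _
  · refine ⟨D.dart e, ?_⟩
    simp only [first_dart]
    exact D.left_directed_eq e _ _ _

/-- A polygonal drawing gives a rotation system that satisfies (one half of) Euler's formula. -/
theorem exists_rotationSystem [Nonempty G.edgeSet] : ∃ (R : G.RotationSystem)
    (f : G.Dart → D.segments.Region), Function.Surjective f ∧ (∀ d, f (R.face d) = f d) ∧
    G.edgeFinset.card + 1 ≤ Fintype.card D.segments.Region + Fintype.card V := by
  obtain ⟨R, hR⟩ := G.exists_rotationSystem (fun d => D.segments.dirKey (D.first d))
    fun d e h hk => D.first_injective (SegmentSystem.dirKey_injective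
      (by rw [src_first, src_first, h]) hk)
  refine ⟨R, fun d => D.segments.left (D.first d), D.left_first_surjective, fun d => ?_, ?_⟩
  -- Counterclockwise, `d.symm` follows `face d`, so the left of `face d` is the right of `d.symm`,
  -- which is the left of `d`.
  · have h1 := (hR d.symm).map (src' := D.segments.src) (key' := D.segments.dirKey) D.first
      (fun d e h => by rw [src_first, src_first, h])
      (fun d f hf => D.exists_first_eq (hf.trans (D.src_first d)))
    have h2 := SegmentSystem.left_eq_of_isCyclicNext h1
    rw [left_first_symm] at h2
    exact h2
  · have h1 := D.segments.card_add_one_le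
    have h2 := D.card_P_le
    omega

end PolygonDrawing

end SimpleGraph

/-! ### From plane drawings to the theorem. -/

/-- Linear coordinates of the plane in which no two points of a finite set lie on a vertical
line. -/
theorem exists_linearMap_fst_inj (S : Set (EuclideanSpace ℝ (Fin 2))) (hS : S.Finite) :
    ∃ T : EuclideanSpace ℝ (Fin 2) →ₗ[ℝ] ℝ × ℝ, Function.Injective T ∧
      ∀ x ∈ S, ∀ y ∈ S, (T x).1 = (T y).1 → T x = T y := by
  -- A shear by `t` aligns two points at different heights for just one value of `t`; finitely many
  -- values are avoided.
  obtain ⟨t, ht⟩ := ((hS.prod hS).image fun z => (z.2 0 - z.1 0) / (z.1 1 - z.2 1)).exists_notMem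
  let T : EuclideanSpace ℝ (Fin 2) →ₗ[ℝ] ℝ × ℝ :=
    { toFun := fun x => (x 0 + t * x 1, x 1)
      map_add' := fun x y => by
        refine Prod.ext ?_ ?_
        · simp only [PiLp.add_apply, Prod.fst_add]; ring
        · simp
      map_smul' := fun c x => by
        refine Prod.ext ?_ ?_
        · simp only [PiLp.smul_apply, smul_eq_mul, RingHom.id_apply, Prod.smul_fst]; ring
        · simp }
  have hT : ∀ x, T x = (x 0 + t * x 1, x 1) := fun _ => rfl
  refine ⟨T, ?_, ?_⟩
  · intro x y hxy
    rw [hT, hT, Prod.mk.injEq] at hxy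
    obtain ⟨h1, h2⟩ := hxy
    ext i
    fin_cases i
    · rw [h2] at h1
      simpa using h1
    · exact h2
  · intro x hx y hy h
    rw [hT, hT] at h ⊢
    simp only at h
    by_cases h1 : x 1 = y 1
    · rw [h1] at h ⊢
      rw [h]
    · refine (ht ⟨(x, y), ⟨hx, hy⟩, ?_⟩).elim
      simp only
      rw [div_eq_iff (sub_ne_zero.2 h1)]
      linarith

namespace SimpleGraph

/-- A drawing of an induced subgraph. -/
def PlaneDrawing.induce {V : Type u} {G : SimpleGraph V} (D : G.PlaneDrawing) (S : Set V) :
    (G.induce S).PlaneDrawing where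
  pos v := D.pos v
  pos_injective := D.pos_injective.comp Subtype.val_injective
  arc e := D.arc (e.map Subtype.val)
  isPolygonalArc_arc u v h := D.isPolygonalArc_arc u v h
  mem_of_pos_mem_arc e he v hv := by
    induction e with
    | _ a b =>
      have := D.mem_of_pos_mem_arc s(a.1, b.1) he v hv
      simpa [Subtype.ext_iff] using this
  exists_of_mem_arc_inter e he f hf hef x hx := by
    induction e with
    | _ a b =>
      induction f with
      | _ c d =>
        obtain ⟨v, h1, h2, h3⟩ := D.exists_of_mem_arc_inter s(a.1, b.1) he s(c.1, d.1) hf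
          (fun h => hef (Sym2.map.injective Subtype.val_injective h)) x hx
        simp only [Sym2.mem_iff] at h1 h2
        rcases h1 with rfl | rfl
        · exact ⟨a, by simp, by simpa [Subtype.ext_iff] using h2, h3⟩
        · exact ⟨b, by simp, by simpa [Subtype.ext_iff] using h2, h3⟩

theorem PlaneDrawing.nonempty_polygonDrawing {V : Type u} [Finite V] {G : SimpleGraph V}
    (D : G.PlaneDrawing) : Nonempty G.PolygonDrawing := by
  have hdart : ∀ e : G.edgeSet, ∃ d : G.Dart, d.edge = e := by
    rintro ⟨e, he⟩
    induction e with
    | _ a b => exact ⟨⟨(a, b), he⟩, rfl⟩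
  choose dart hedge using hdart
  have harc : ∀ e, IsPolygonalArc (D.pos (dart e).fst) (D.pos (dart e).snd) (D.arc e) := by
    intro e
    have := D.isPolygonalArc_arc _ _ (dart e).adj
    rw [← hedge e]
    exact this
  choose n p h0 hn hinj hA hseg using harc
  have hsub : ∀ e i, i < n e → segment ℝ (p e i) (p e (i + 1)) ⊆ D.arc e := by
    intro e i hi x hx
    rw [hA e]
    exact Set.mem_biUnion hi hx
  have hfin : (⋃ e, p e '' Set.Iic (n e)).Finite :=
    Set.finite_iUnion fun e => (Set.finite_Iic _).image _
  obtain ⟨T, hTinj, hT⟩ := exists_linearMap_fst_inj _ hfin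
  have hTseg : ∀ e i x, x ∈ segment ℝ (T (p e i)) (T (p e (i + 1))) →
      ∃ y ∈ segment ℝ (p e i) (p e (i + 1)), T y = x := by
    intro e i x hx
    have := image_segment ℝ T.toAffineMap (p e i) (p e (i + 1))
    simp only [LinearMap.coe_toAffineMap] at this
    rw [← this] at hx
    exact hx
  exact ⟨{
    dart := dart
    edge_dart := hedge
    n := n
    pos := fun v => T (D.pos v)
    q := fun e i => T (p e i)
    q_zero := fun e => by rw [h0]
    q_n := fun e => by rw [hn]
    pos_injective := hTinj.comp D.pos_injective
    q_injOn := fun e => hTinj.injOn.comp (hinj e) (Set.mapsTo_univ _ _)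
    same := by
      intro e i j x hij hj h1 h2
      obtain ⟨y, hy, rfl⟩ := hTseg e i x h1
      obtain ⟨z, hz, hzy⟩ := hTseg e j _ h2
      rw [hTinj hzy] at hz
      obtain ⟨h3, h4⟩ := hseg e i j hij hj y ⟨hy, hz⟩
      exact ⟨h3, by rw [h4]⟩
    pos_mem := by
      intro e i v hi hv
      obtain ⟨y, hy, hyv⟩ := hTseg e i _ hv
      rw [hTinj hyv] at hy
      have := D.mem_of_pos_mem_arc e e.2 v (hsub e i hi hy)
      rw [← hedge e] at this
      exact Sym2.mem_iff.1 this
    ne := by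
      intro e e' i j x he hi hj h1 h2
      obtain ⟨y, hy, rfl⟩ := hTseg e i x h1
      obtain ⟨z, hz, hzy⟩ := hTseg e' j _ h2
      rw [hTinj hzy] at hz
      obtain ⟨v, -, -, hv⟩ := D.exists_of_mem_arc_inter e e.2 e' e'.2
        (fun h => he (Subtype.ext h)) y ⟨hsub e i hi hy, hsub e' j hj hz⟩
      exact ⟨v, by rw [hv]⟩
    fst_inj := by
      intro e e' i j hi hj h
      exact hT _ (Set.mem_iUnion.2 ⟨e, i, hi, rfl⟩) _ (Set.mem_iUnion.2 ⟨e', j, hj, rfl⟩) h }⟩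

theorem false_of_triangle_of_four_cycle {V : Type u} {G : SimpleGraph V}
    (hcycles : ∀ (x y : V) (c : G.Walk x x) (d : G.Walk y y),
      c.IsCycle → c.length = 4 → d.IsCycle → d.length = 3 →
      ¬ ∃ e : Sym2 V, e ∈ c.edges ∧ e ∈ d.edges)
    (a b c x y : V) (hab : G.Adj a b) (hac : G.Adj a c) (hbc : G.Adj b c) (hbx : G.Adj b x)
    (hxy : G.Adj x y) (hya : G.Adj y a) (hxa : x ≠ a) (hyb : y ≠ b) : False := by
  refine hcycles a a (.cons hab (.cons hbx (.cons hxy (.cons hya .nil))))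
    (.cons hab (.cons hbc (.cons hac.symm .nil))) ?_ rfl ?_ rfl ⟨s(a, b), by simp, by simp⟩
  · simp [Walk.cons_isCycle_iff, Walk.cons_isPath_iff, hab.ne, hab.ne', hbx.ne, hxy.ne,
      hya.ne, hya.ne', hxa, hxa.symm, hyb.symm]
  · simp [Walk.cons_isCycle_iff, Walk.cons_isPath_iff, hab.ne, hab.ne', hac.ne, hac.ne', hbc.ne]

theorem MatchingAssignment.Critical.isCriticalLike {V : Type u} [Fintype V] [DecidableEq V]
    {G : SimpleGraph V} [DecidableRel G.Adj] {C : Type w} {L : V → Set C}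
    {M : G.MatchingAssignment L} (hM : M.Critical)
    (h : ∀ a b c x y, G.Adj a b → G.Adj a c → G.Adj b c → G.Adj b x → G.Adj x y → G.Adj y a →
      x ≠ a → y ≠ b → False) : G.IsCriticalLike where
  four_le_degree := hM.four_le_degree
  triangle_unique a b c d hab hac hbc had hbd := by
    -- Two triangles on `a b` form the 4-cycle a, c, b, d, which shares `a c` with the triangle a,
    -- c, b.
    by_contra hcd
    exact h a c b b d hac hab hbc.symm hbc.symm hbd had.symm hab.ne' (Ne.symm hcd)
  triangle_four_cycle := h
  cycle := hM.false_of_cycle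

theorem MatchingAssignment.exists_properOn_univ {V : Type u} [Finite V] {G : SimpleGraph V}
    (hplanar : G.IsPlanar)
    (h : ∀ a b c x y, G.Adj a b → G.Adj a c → G.Adj b c → G.Adj b x → G.Adj x y → G.Adj y a →
      x ≠ a → y ≠ b → False)
    {C : Type w} {L : V → Set C} (hL : ∀ v, 4 ≤ (L v).encard) (M : G.MatchingAssignment L) :
    ∃ f, M.ProperOn Set.univ f := by
  classical
  by_contra hcon
  push Not at hcon
  obtain ⟨S, hS⟩ := M.exists_critical hL hcon
  obtain ⟨D⟩ := hplanar
  obtain ⟨D'⟩ := (D.induce S).nonempty_polygonDrawing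
  have : Fintype S := Fintype.ofFinite S
  have hG : (G.induce S).IsCriticalLike := hS.isCriticalLike
    fun a b c x y h1 h2 h3 h4 h5 h6 h7 h8 =>
      h a b c x y h1 h2 h3 h4 h5 h6 (fun h => h7 (Subtype.ext h)) (fun h => h8 (Subtype.ext h))
  have hne : Nonempty (G.induce S).edgeSet := by
    have hSne : Nonempty S := by
      by_contra hempty
      rw [not_nonempty_iff] at hempty
      exact hS.not_properOn_univ (fun v => hempty.elim v) fun u => hempty.elim u
    obtain ⟨v⟩ := hSne
    have h4 := hG.four_le_degree v
    obtain ⟨u, hu⟩ := (degree_pos_iff_exists_adj _ v).1 (Nat.zero_lt_of_lt h4)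
    exact ⟨⟨s(v, u), hu⟩⟩
  obtain ⟨R, f, hf, hinv, hcard⟩ := D'.exists_rotationSystem
  -- Discharging bounds regions plus vertices by the edges, against `hcard`.
  have := RotationSystem.card_add_card_le hG f hf hinv
  omega

end SimpleGraph

theorem theorem2 {V : Type u} [Fintype V] (G : SimpleGraph V) (hplanar : G.IsPlanar)
    (hcycles : ∀ (x y : V) (c : G.Walk x x) (d : G.Walk y y),
      c.IsCycle → c.length = 4 → d.IsCycle → d.length = 3 →
      ¬ ∃ e : Sym2 V, e ∈ c.edges ∧ e ∈ d.edges) :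
    SimpleGraph.dpChromaticNumber.{u, w} G ≤ 4 := by
  refine iInf₂_le (4 : ℕ) ?_
  intro C L hL M
  obtain ⟨f, hf⟩ := SimpleGraph.MatchingAssignment.exists_properOn_univ hplanar
    (SimpleGraph.false_of_triangle_of_four_cycle hcycles) hL M
  exact M.colorable_of_properOn_univ f hf
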